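/- **Setting.** A *dimer* is a finite connected bipartite graph (multiple edges allowed) with vertices ("nodes") coloured black and white, embedded in the oriented torus $T^2$ so that all faces are open discs. A *perfect matching* is a set of edges such that each node is an endpoint of exactly one of them. A *zigzag path* is a closed path that turns alternately to the counterclockwise next edge (at white nodes) and to the clockwise next edge (at black nodes); each edge is run through by the zigzag paths exactly twice, once in each direction. Each zigzag path has a winding number in $H_1(T^2;\mathbb Z)\cong\mathbb Z^2$ (with respect to a positively oriented basis). The dimer is *properly ordered* if around each node the cyclic order of the zigzag paths passing through it is the same as the circular order of the directions of their winding numbers; in particular these winding numbers are nonzero and have pairwise distinct directions. Fix two closed curves $\gamma_w,\gamma_z$ whose classes generate the homology of $T^2$ and, for each edge $e$, let $(a_e,b_e)\in\mathbb Z^2$ be the signed numbers of crossings of $\gamma_w$, $\gamma_z$ with $e$ (counted positively if the white endpoint is on the left of the curve). The *Kasteleyn matrix* has rows indexed by the white nodes and columns indexed by the black nodes; its entries are the sums of the weights $c_e w^{a_e}z^{b_e}$ of the edges $e$ joining the two nodes, where the $c_e$ are arbitrary nonzero complex numbers. The *toric diagram* is the Newton polygon of its determinant, a Laurent polynomial in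 $w,z$. A perfect matching $M$ is *at* the lattice point $\sum_{e\in M}(a_e,b_e)$. If $M$ contains exactly half of the edges of a zigzag path $Z$, *flipping* $Z$ means to delete these edges from $M$ and to add the other half of the edges of $Z$. **Statement.** Let a properly ordered dimer be given, and let $A$ be a lattice point on the boundary of its toric diagram such that the nearest corner $B$ in the counterclockwise direction is $p$ segments away and the nearest corner $C$ in the clockwise direction is $q$ segments away (segments join consecutive lattice points of the boundary). Then there is exactly one perfect matching $M_B$ at $B$ and exactly one perfect matching $M_C$ at $C$. Each perfect matching at $A$ may be obtained from $M_B$ by flipping $p$ distinct, pairwise edge-disjoint zigzag paths, and from $M_C$ by flipping $q$ distinct, pairwise edge-disjoint zigzag paths. The number of perfect matchings at $A$ is $\binom{p+q}{q}$. -/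

import Mathlib

noncomputable section

/-- The wedge `(a, b) ∧ (c, d) = a d - b c` on `ℤ²`. -/
def wedge (u v : ℤ × ℤ) : ℤ := u.1 * v.2 - u.2 * v.1

/-- The directions of `u`, `v`, `w` are pairwise distinct and are met in this order when one turns
counterclockwise. (Of the three counterclockwise angles `u → v → w → u`, which then add up to one
revolution, at least two lie strictly between `0` and `π`; conversely, two such angles force this
order.) -/
def CcwOrdered (u v w : ℤ × ℤ) : Prop :=
  (0 < wedge u v ∧ 0 < wedge v w) ∨ (0 < wedge v w ∧ 0 < wedge w u) ∨
    (0 < wedge w u ∧ 0 < wedge u v)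

/-- A bipartite graph with edge set `E` cellularly embedded in an oriented closed surface, given by
its rotation system: `white e` (resp. `black e`) is the edge that follows `e` in counterclockwise
order around the white (resp. black) endpoint of `e`. Nodes and faces are recovered as orbits;
multiple edges are allowed. -/
structure BipartiteMap (E : Type*) where
  white : Equiv.Perm E
  black : Equiv.Perm E

namespace BipartiteMap

variable {E : Type*} (G : BipartiteMap E)

/-- White nodes: orbits of the rotation `white`. -/
abbrev WhiteNode : Type _ := Quotient (Equiv.Perm.SameCycle.setoid G.white)

/-- Black nodes: orbits of the rotation `black`. -/
abbrev BlackNode : Type _ := Quotient (Equiv.Perm.SameCycle.setoid G.black)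

/-- The white endpoint of an edge. -/
def whiteEnd (e : E) : G.WhiteNode := Quotient.mk _ e

/-- The black endpoint of an edge. -/
def blackEnd (e : E) : G.BlackNode := Quotient.mk _ e

/-- Walk along the boundary of the face on the left of `e`, where `e` is run through from white to
black: at the black end the next edge of that face is `black⁻¹ e`, run through from black to white,
and at its white end the next one is `white⁻¹ (black⁻¹ e)`, run through from white to black. -/
def facePerm : Equiv.Perm E := G.white⁻¹ * G.black⁻¹

/-- Faces; `e` represents the face on its left when `e` is run through from white to black. -/
abbrev Face : Type _ := Quotient (Equiv.Perm.SameCycle.setoid G.facePerm)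

/-- One step of a zigzag path. A zigzag path that runs through `e` from black to white goes on with
the counterclockwise next edge `white e`, which it runs through from white to black, and then with
the clockwise next edge `black⁻¹ (white e)`, run through from black to white again. -/
def zigzagPerm : Equiv.Perm E := G.black⁻¹ * G.white

/-- Zigzag paths, oriented counterclockwise around white nodes and clockwise around black nodes;
`e` represents the zigzag path that runs through `e` from black to white. -/
abbrev Zigzag : Type _ := Quotient (Equiv.Perm.SameCycle.setoid G.zigzagPerm)

/-- The zigzag path that runs through `e` from black to white. It goes from `e` to `white e` around
the white endpoint of `e`. -/
def zigzagToWhite (e : E) : G.Zigzag := Quotient.mk _ e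

/-- The zigzag path that runs through `e` from white to black. It goes from `e` to `black⁻¹ e`
around the black endpoint of `e`. -/
def zigzagToBlack (e : E) : G.Zigzag := Quotient.mk _ (G.white⁻¹ e)

section Finite

variable [Fintype E]

open Classical in
instance : Fintype G.WhiteNode := Fintype.ofFinite _

open Classical in
instance : Fintype G.BlackNode := Fintype.ofFinite _

open Classical in
instance : Fintype G.Face := Fintype.ofFinite _

open Classical in
/-- The set of edges of a zigzag path. -/
def zigzagEdges (Z : G.Zigzag) : Finset E :=
  Finset.univ.filter fun e => G.zigzagToWhite e = Z ∨ G.zigzagToBlack e = Z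

open Classical in
/-- The total displacement around a face, when running through an edge `e` from white to black is a
displacement by `h e`. -/
def faceSum (h : E → ℤ × ℤ) (f : G.Face) : ℤ × ℤ :=
  ∑ e ∈ Finset.univ.filter (fun e => Quotient.mk _ e = f), (h e - h (G.black⁻¹ e))

/-- For a displacement `h` with face sums zero, unfold the boundary of the face `f`
to a closed polygon in the plane, from the white node of the edge `f.out` at the origin:
this is the position of the white node after `i` pairs of edges. -/
def facePos (h : E → ℤ × ℤ) (f : G.Face) (i : ℕ) : ℤ × ℤ :=
  ∑ j ∈ Finset.range i, (h ((G.facePerm ^ j) f.out) - h (G.black⁻¹ ((G.facePerm ^ j) f.out)))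

/-- Twice the signed area (shoelace formula) of the polygon to which the face `f` unfolds. Its
vertices are, alternately, the white node positions and the black node positions. -/
def faceDoubleArea (h : E → ℤ × ℤ) (f : G.Face) : ℤ :=
  ∑ i ∈ Finset.range (Function.minimalPeriod G.facePerm f.out),
    (wedge (G.facePos h f i) (G.facePos h f i + h ((G.facePerm ^ i) f.out)) +
      wedge (G.facePos h f i + h ((G.facePerm ^ i) f.out)) (G.facePos h f (i + 1)))

end Finite

end BipartiteMap

/-- A dimer model: a finite connected bipartite graph that is cellularly embedded in the oriented
torus, with the exponents of its Kasteleyn matrix. The weight of the edge `e` is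
`w ^ (weight e).1 * z ^ (weight e).2` up to a constant, where the exponents are the signed crossing
numbers of `e`, run through from white to black, with two closed curves `γ_w`, `γ_z` whose classes
generate the homology of the torus. Thus the weights add up to the winding number in `ℤ²` along any
closed path of the dimer. For a cochain `weight` this says that it vanishes on the boundary of each
face, so that it induces a map from the torus to `ℝ² / ℤ²`, and that this map has degree one,
that is, that the unfolded faces have total signed area one. (A positively oriented basis of
the homology is used, so that winding numbers have the orientation of the torus.) -/
structure TorusDimer (E : Type*) [Fintype E] extends BipartiteMap E where
  connected : MulAction.IsPretransitive (Subgroup.closure {white, black}) E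
  euler : (Nat.card toBipartiteMap.WhiteNode : ℤ) + Nat.card toBipartiteMap.BlackNode
    - Fintype.card E + Nat.card toBipartiteMap.Face = 0
  weight : E → ℤ × ℤ
  weight_face : ∀ f : toBipartiteMap.Face, toBipartiteMap.faceSum weight f = 0
  weight_degree : ∑ f : toBipartiteMap.Face, toBipartiteMap.faceDoubleArea weight f = 2

namespace TorusDimer

variable {E : Type*} [Fintype E] (D : TorusDimer E)

open Classical in
/-- The winding number of a zigzag path: run through each pair of consecutive edges `e` (from black
to white) and `white e` (from white to black). -/
def winding (Z : D.Zigzag) : ℤ × ℤ :=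
  ∑ e ∈ Finset.univ.filter (fun e => D.zigzagToWhite e = Z), (D.weight (D.white e) - D.weight e)

/-- Let `rot` be the rotation around a node and `w e` the winding of the zigzag path that goes, at
this node, from one to the other of two neighbouring edges, the pairs of neighbours being indexed by
edges `e` in counterclockwise order. The order of the directions of the windings is the order of
the paths around the node with the edge `e`; in particular these directions exist and
are pairwise distinct. -/
def OrderedAround (rot : Equiv.Perm E) (w : E → ℤ × ℤ) (e : E) : Prop :=
  w e ≠ 0 ∧
  (∀ i, 0 < i → i < Function.minimalPeriod rot e → ¬ SameRay ℤ (w e) (w ((rot ^ i) e))) ∧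
  (∀ i j, 0 < i → i < j → j < Function.minimalPeriod rot e →
    CcwOrdered (w e) (w ((rot ^ i) e)) (w ((rot ^ j) e)))

/-- A dimer is properly ordered if around each node the order of the zigzag paths is the
circular order of the directions of their windings. -/
def ProperlyOrdered : Prop :=
  (∀ e, OrderedAround D.white (fun e => D.winding (D.zigzagToWhite e)) e) ∧
  (∀ e, OrderedAround D.black (fun e => D.winding (D.zigzagToBlack e)) e)

/-- A perfect matching: each node is an endpoint of exactly one of the edges. -/
def IsPerfectMatching (M : Finset E) : Prop :=
  (∀ v : D.WhiteNode, ∃! e, e ∈ M ∧ D.whiteEnd e = v) ∧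
  (∀ v : D.BlackNode, ∃! e, e ∈ M ∧ D.blackEnd e = v)

open Classical in
/-- The Kasteleyn matrix with coefficients `c`, over the Laurent polynomials in two variables
(`single (a, b) 1` is the monomial `w ^ a * z ^ b`). -/
def kasteleyn (c : E → ℂ) : Matrix D.WhiteNode D.BlackNode (AddMonoidAlgebra ℂ (ℤ × ℤ)) :=
  Matrix.of fun v v' => ∑ e ∈ Finset.univ.filter (fun e => D.whiteEnd e = v ∧ D.blackEnd e = v'),
    AddMonoidAlgebra.single (D.weight e) (c e)

open Classical in
/-- The determinant of the Kasteleyn matrix; it is defined up to sign, through an arbitrary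
identification of rows with columns, and is zero if the matrix is not square. -/
def kasteleynDet (c : E → ℂ) : AddMonoidAlgebra ℂ (ℤ × ℤ) :=
  if h : Nonempty (D.WhiteNode ≃ D.BlackNode) then
    ((D.kasteleyn c).submatrix id h.some).det
  else 0

/-- A lattice point as a point of the real plane. -/
def latticePoint (A : ℤ × ℤ) : ℝ × ℝ := ((A.1 : ℝ), (A.2 : ℝ))

/-- The toric diagram: the Newton polygon of the determinant of the Kasteleyn matrix. -/
def toricDiagram (c : E → ℂ) : Set (ℝ × ℝ) :=
  convexHull ℝ (latticePoint '' ((D.kasteleynDet c).coeff.support : Set (ℤ × ℤ)))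

/-- The set of perfect matchings at the lattice point `A`: those whose term in the determinant of
the Kasteleyn matrix is a multiple of the monomial with exponent `A`. -/
def matchingsAt (A : ℤ × ℤ) : Set (Finset E) :=
  {M | D.IsPerfectMatching M ∧ ∑ e ∈ M, D.weight e = A}

open Classical in
/-- `M'` arises from the perfect matching `M` by flipping `n` zigzag paths. Flipping replaces the
edges of the path that are in `M`, which have to be half of its edges, by the other half. The `n`
distinct paths have no edges in common, so that they can be flipped in any order. -/
def ArisesByFlipping (M : Finset E) (n : ℕ) (M' : Finset E) : Prop :=
  ∃ S : Finset D.Zigzag, S.card = n ∧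
    (∀ Z ∈ S, 2 * (M ∩ D.zigzagEdges Z).card = (D.zigzagEdges Z).card) ∧
    (∀ Z ∈ S, ∀ Z' ∈ S, Z ≠ Z' → Disjoint (D.zigzagEdges Z) (D.zigzagEdges Z')) ∧
    M' = (M \ S.biUnion D.zigzagEdges) ∪ (S.biUnion D.zigzagEdges \ M)

end TorusDimer

open TorusDimer in
/-- `A` is a lattice point on the boundary of the polygon `P`, the nearest corner in the
counterclockwise direction is `B`, at a distance of `p` segments between consecutive lattice
points, and the nearest corner in the clockwise direction is `C`, at a distance of `q` segments.
That is, `u` is a primitive vector, the line through `A` in the direction `u` has `P` on its left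
(so that `u` points counterclockwise along the boundary), and `C`, `A`, `B` lie on it in this
order. (Being extreme points, `B` and `C` are the first corners on either side. If `A` is itself a
corner, this allows `p = 0`, `B = A` or `q = 0`, `C = A`.) -/
def BoundaryPosition (P : Set (ℝ × ℝ)) (A B C : ℤ × ℤ) (p q : ℕ) : Prop :=
  latticePoint B ∈ P.extremePoints ℝ ∧ latticePoint C ∈ P.extremePoints ℝ ∧
  ∃ u : ℤ × ℤ, IsCoprime u.1 u.2 ∧
    (∀ x ∈ P, 0 ≤ (u.1 : ℝ) * (x.2 - A.2) - (u.2 : ℝ) * (x.1 - A.1)) ∧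
    B = A + p • u ∧ C = A - q • u

end

noncomputable section

/-! A perfect matching is treated as an integral cochain with all node sums 1, so that differences
of matchings are cycles. The cochain counting the passages of a zigzag path `Z` is Poincaré dual to
`Z`: up to a coboundary it is minus the wedge of the winding of `Z` with the weight
(`exists_zigzag_potential`). Coboundaries vanish on cycles, so the number of edges of a matching on
`Z` is an affine function of its position (`IsMatching.crossing_sub`). Consecutive edges of `Z`
share a node, so this number is at most half the length of `Z`. Hence a matching containing half of
`Z` lies on a supporting line, parallel to the winding of `Z`, of the set of all positions.

Proper ordering supplies such matchings. Cut the circle of directions at a point. Around each node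
exactly one edge has the cut between the directions of its two zigzag paths, and these edges form a
perfect matching (`isMatching_cut`) that contains half of each path next to the cut. Moving the cut
across a direction flips the paths of that direction. So the cuts just before and just after a
primitive vector `u` are the two ends of the side in the direction `u`. They differ by flips of the
paths with this direction. These are edge-disjoint, and since windings are primitive
(`winding_ne_smul`), each flip moves the position by exactly `u`.

Conversely, a matching on the side contains half of each of these paths. Undoing its flips keeps it
on the line, where the supporting lines of the neighbouring directions force it into the end of the
side. The matching there is unique (`eq_cut`): sweeping the cut through the directions shows path by
path that it agrees with the cut. Matchings on a side thus correspond to subsets of its paths, with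
the position given by the size of the subset; this yields the flips and the binomial coefficient.
Uniqueness at the ends also excludes cancellation in the determinant, so the ends lie in the Newton
polygon and are the only possible extreme points on the line. -/

/-! ### Orbits of a permutation -/

theorem Equiv.Perm.exists_pow_of_mk_eq {E : Type*} [Fintype E] (σ : Equiv.Perm E) (x e : E)
    (h : Quotient.mk (Equiv.Perm.SameCycle.setoid σ) e = Quotient.mk _ x) :
    ∃ i < Function.minimalPeriod σ x, (σ ^ i) x = e := by
  have h1 : σ.SameCycle e x := Quotient.exact h
  obtain ⟨i, -, hi⟩ := h1.symm.exists_pow_eq'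
  refine ⟨i % Function.minimalPeriod σ x, Nat.mod_lt _ ?_, ?_⟩
  · exact Function.minimalPeriod_pos_of_mem_periodicPts
      (Function.Injective.mem_periodicPts σ.injective x)
  · rw [Equiv.Perm.coe_pow, Function.iterate_mod_minimalPeriod_eq, ← Equiv.Perm.coe_pow, hi]

open scoped Classical in
/-- The sum over an orbit, as a sum over the powers of the permutation. -/
theorem Equiv.Perm.sum_orbit {E A : Type*} [Fintype E] [AddCommMonoid A] (σ : Equiv.Perm E) (x : E)
    (F : E → A) :
    ∑ e ∈ Finset.univ.filter (fun e => (Quotient.mk (Equiv.Perm.SameCycle.setoid σ) e) =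
      Quotient.mk (Equiv.Perm.SameCycle.setoid σ) x), F e =
    ∑ i ∈ Finset.range (Function.minimalPeriod σ x), F ((σ ^ i) x) := by
  have hinj : Set.InjOn (fun i : ℕ => (σ ^ i) x) (Finset.range (Function.minimalPeriod σ x)) := by
    intro i hi j hj hij
    simp only [Equiv.Perm.coe_pow] at hij
    exact Function.iterate_injOn_Iio_minimalPeriod (by simpa using hi) (by simpa using hj) hij
  rw [← Finset.sum_image (f := F) (g := fun i : ℕ => (σ ^ i) x) hinj]
  congr 1
  ext e
  simp only [Finset.mem_filter, Finset.mem_univ, true_and, Finset.mem_image, Finset.mem_range]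
  constructor
  · exact σ.exists_pow_of_mk_eq x e
  · rintro ⟨i, -, rfl⟩
    exact Quotient.sound (⟨-i, by simp⟩ : σ.SameCycle _ _)

theorem Equiv.Perm.mk_apply {E : Type*} (σ : Equiv.Perm E) (e : E) :
    Quotient.mk (Equiv.Perm.SameCycle.setoid σ) (σ e) = Quotient.mk _ e :=
  Quotient.sound (⟨-1, by simp⟩ : σ.SameCycle _ _)

/-- A function that is constant on orbits is a function on the set of orbits. -/
theorem Equiv.Perm.lift_of_invariant {E A : Type*} (σ : Equiv.Perm E) (k : E → A)
    (hk : ∀ e, k (σ e) = k e) {x y : E} (h : σ.SameCycle x y) : k x = k y := by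
  obtain ⟨i, rfl⟩ := h
  have hinv : ∀ e, k (σ⁻¹ e) = k e := fun e => by
    have := hk (σ⁻¹ e)
    simpa using this.symm
  induction i using Int.induction_on with
  | zero => simp
  | succ n ih => rw [add_comm, zpow_add, zpow_one, Equiv.Perm.mul_apply, hk, ← ih]
  | pred n ih =>
    rw [sub_eq_add_neg, add_comm, zpow_add, zpow_neg_one, Equiv.Perm.mul_apply, hinv, ← ih]

/-! ### Unfolding the faces -/

namespace BipartiteMap

variable {E : Type*} (G : BipartiteMap E)

@[simp] theorem whiteEnd_white (e : E) : G.whiteEnd (G.white e) = G.whiteEnd e :=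
  G.white.mk_apply e

@[simp] theorem blackEnd_black (e : E) : G.blackEnd (G.black e) = G.blackEnd e :=
  G.black.mk_apply e

@[simp] theorem blackEnd_black_inv (e : E) : G.blackEnd (G.black⁻¹ e) = G.blackEnd e := by
  simpa using (G.blackEnd_black (G.black⁻¹ e)).symm

@[simp] theorem zigzagToBlack_white (e : E) :
    G.zigzagToBlack (G.white e) = G.zigzagToWhite e := by
  simp [zigzagToBlack, zigzagToWhite]

theorem zigzagToWhite_zigzagPerm (e : E) :
    G.zigzagToWhite (G.zigzagPerm e) = G.zigzagToWhite e :=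
  G.zigzagPerm.mk_apply e

theorem zigzagToWhite_black_inv (e : E) :
    G.zigzagToWhite (G.black⁻¹ e) = G.zigzagToBlack e := by
  change _ = G.zigzagToWhite (G.white⁻¹ e)
  simpa [zigzagPerm] using G.zigzagToWhite_zigzagPerm (G.white⁻¹ e)

@[simp] theorem zigzagToBlack_black (e : E) :
    G.zigzagToBlack (G.black e) = G.zigzagToWhite e := by
  rw [← zigzagToWhite_black_inv]; simp

section Finite

variable [Fintype E]

theorem faceSum_eq_sum_range (h : E → ℤ × ℤ) (f : G.Face) :
    G.faceSum h f = G.facePos h f (Function.minimalPeriod G.facePerm f.out) := by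
  classical
  have := G.facePerm.sum_orbit f.out (fun e => h e - h (G.black⁻¹ e))
  rw [Quotient.out_eq] at this
  rw [facePos, ← this, faceSum]

/-- A displacement with face sums zero has a potential on each face. -/
theorem exists_face_potential (h : E → ℤ × ℤ) (hh : ∀ f, G.faceSum h f = 0) :
    ∃ P : E → ℤ × ℤ, (∀ e, P (G.facePerm e) = P e + h e - h (G.black⁻¹ e)) ∧
      ∑ f, G.faceDoubleArea h f =
        ∑ e, (wedge (P e) (P e + h e) + wedge (P e + h e) (P (G.facePerm e))) := by
  classical
  have hex : ∀ e : E, ∃ i < Function.minimalPeriod G.facePerm (Quotient.mk _ e : G.Face).out,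
      (G.facePerm ^ i) (Quotient.mk _ e : G.Face).out = e := fun e =>
    G.facePerm.exists_pow_of_mk_eq _ _ (Quotient.out_eq _).symm
  choose i hi hie using hex
  have hmk : ∀ (f : G.Face) (j : ℕ), (Quotient.mk _ ((G.facePerm ^ j) f.out) : G.Face) = f := by
    intro f j
    refine Eq.trans ?_ (Quotient.out_eq f)
    exact Quotient.sound (⟨-j, by simp⟩ : G.facePerm.SameCycle _ _)
  have hn : ∀ f : G.Face, 0 < Function.minimalPeriod G.facePerm f.out := fun f =>
    Function.minimalPeriod_pos_of_mem_periodicPts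
      (Function.Injective.mem_periodicPts G.facePerm.injective _)
  -- The value `j` equal to the period is included: there the walk is back at its start, where the
  -- chosen index is 0, and the two positions agree because the face sum vanishes.
  have hP : ∀ (f : G.Face) (j : ℕ), j ≤ Function.minimalPeriod G.facePerm f.out →
      G.facePos h (Quotient.mk _ ((G.facePerm ^ j) f.out)) (i ((G.facePerm ^ j) f.out)) =
        G.facePos h f j := by
    intro f j hj
    have h1 := hie ((G.facePerm ^ j) f.out)
    have h2 := hi ((G.facePerm ^ j) f.out)
    rw [hmk] at h1 h2 ⊢
    rcases hj.lt_or_eq with hj | hj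
    · congr 1
      simp only [Equiv.Perm.coe_pow] at h1 h2 ⊢
      exact Function.iterate_injOn_Iio_minimalPeriod (f := G.facePerm) h2 hj h1
    · have h3 : (G.facePerm ^ j) f.out = f.out := by
        rw [hj, Equiv.Perm.coe_pow]; exact Function.iterate_minimalPeriod
      have h4 : i ((G.facePerm ^ j) f.out) = 0 := by
        rw [h3] at h1 h2 ⊢
        simp only [Equiv.Perm.coe_pow] at h1
        exact Function.iterate_injOn_Iio_minimalPeriod (f := G.facePerm) h2 (hn f) h1
      rw [h4, hj, ← faceSum_eq_sum_range, hh, facePos, Finset.sum_range_zero]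
  refine ⟨fun e => G.facePos h (Quotient.mk _ e) (i e), ?_, ?_⟩
  · intro e
    have h1 := hP (Quotient.mk _ e) (i e + 1) (hi e)
    have h2 : (G.facePerm ^ (i e + 1)) (Quotient.mk _ e : G.Face).out = G.facePerm e := by
      rw [add_comm, pow_add, pow_one, Equiv.Perm.mul_apply, hie]
    rw [h2] at h1
    simp only
    rw [h1, facePos, Finset.sum_range_succ, ← facePos, hie]
    abel
  · rw [← Finset.sum_fiberwise (s := Finset.univ)
      (g := fun e : E => (Quotient.mk _ e : G.Face)) (f := fun e => _)]
    refine Finset.sum_congr rfl fun f _ => ?_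
    have := G.facePerm.sum_orbit f.out (fun e =>
      (wedge (G.facePos h (Quotient.mk _ e) (i e)) (G.facePos h (Quotient.mk _ e) (i e) + h e) +
        wedge (G.facePos h (Quotient.mk _ e) (i e) + h e)
          (G.facePos h (Quotient.mk _ (G.facePerm e)) (i (G.facePerm e)))))
    rw [Quotient.out_eq] at this
    rw [this, faceDoubleArea]
    refine Finset.sum_congr rfl fun j hj => ?_
    rw [Finset.mem_range] at hj
    have h2 : G.facePerm ((G.facePerm ^ j) f.out) = (G.facePerm ^ (j + 1)) f.out := by
      rw [add_comm, pow_add, pow_one, Equiv.Perm.mul_apply]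
    rw [h2, hP f j hj.le, hP f (j + 1) hj]

end Finite

end BipartiteMap

/-! ### Cup products of cochains -/

namespace BipartiteMap

variable {E : Type*} (G : BipartiteMap E)

theorem white_facePerm (e : E) : G.white (G.facePerm e) = G.black⁻¹ e := by
  simp [facePerm]

/-- A property that the two rotations preserve holds for all edges as soon as it holds for one. -/
theorem forall_of_connected
    (hG : MulAction.IsPretransitive (Subgroup.closure {G.white, G.black}) E)
    {p : E → Prop} (hw : ∀ e, p (G.white e) ↔ p e) (hb : ∀ e, p (G.black e) ↔ p e)
    {e₀ : E} (h₀ : p e₀) (e : E) : p e := by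
  have key : ∀ g ∈ Subgroup.closure {G.white, G.black}, ∀ e, p (g e) ↔ p e := by
    intro g hg
    induction hg using Subgroup.closure_induction with
    | mem x hx =>
      rcases hx with rfl | rfl
      · exact hw
      · exact hb
    | one => simp
    | mul x y _ _ hx hy => intro e; rw [Equiv.Perm.mul_apply, hx, hy]
    | inv x _ hx =>
      intro e
      have := hx (x⁻¹ e)
      rw [← this]; simp
  obtain ⟨⟨g, hg⟩, h⟩ := hG.exists_smul_eq e₀ e
  rw [← h]
  exact (key g hg e₀).2 h₀

theorem eq_of_connected {A : Type*}
    (hG : MulAction.IsPretransitive (Subgroup.closure {G.white, G.black}) E)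
    {k : E → A} (hw : ∀ e, k (G.white e) = k e) (hb : ∀ e, k (G.black e) = k e)
    (e e' : E) : k e = k e' :=
  G.forall_of_connected hG (p := fun e => k e = k e') (fun e => by simp only [hw])
    (fun e => by simp only [hb]) (e₀ := e') rfl e

section Finite

variable [Fintype E]

/-- Twice the integral of the cup product of the cochain `χ`, which has the potential `X` on each
face, with `φ`. -/
def cup (X χ : E → ℚ) : (E → ℚ) →ₗ[ℚ] ℚ where
  -- Trapezoidal rule around a face: each side contributes the signed value of `φ` times the sum of
  -- the potential of `χ` at its two ends. The second term is the side `black⁻¹ e`, run through from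
  -- black to white.
  toFun φ := ∑ e, ((2 * X e + χ e) * φ e -
    (2 * X e + 2 * χ e - χ (G.black⁻¹ e)) * φ (G.black⁻¹ e))
  map_add' φ ψ := by
    rw [← Finset.sum_add_distrib]
    exact Finset.sum_congr rfl fun e _ => by simp only [Pi.add_apply]; ring
  map_smul' c φ := by
    rw [smul_eq_mul, Finset.mul_sum]
    exact Finset.sum_congr rfl fun e _ => by
      simp only [Pi.smul_apply, smul_eq_mul, RingHom.id_apply]; ring

theorem cup_apply (X χ φ : E → ℚ) : G.cup X χ φ = ∑ e, ((2 * X e + χ e) * φ e -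
    (2 * X e + 2 * χ e - χ (G.black⁻¹ e)) * φ (G.black⁻¹ e)) := rfl

variable {X χ : E → ℚ} (hX : ∀ e, X (G.facePerm e) = X e + χ e - χ (G.black⁻¹ e))

-- Each side of a face contributes a difference of squares of the potential, so the sum telescopes.
include hX in
theorem cup_self : G.cup X χ χ = 0 := by
  have h := Equiv.sum_comp G.facePerm fun e => X e ^ 2
  rw [cup_apply, ← sub_eq_zero.2 h, ← Finset.sum_sub_distrib]
  refine Finset.sum_congr rfl fun e _ => ?_
  rw [hX]; ring

include hX in
/-- The cup product with a coboundary vanishes. -/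
theorem cup_coboundary {g k : E → ℚ} (hg : ∀ e, g (G.white e) = g e)
    (hk : ∀ e, k (G.black e) = k e) : G.cup X χ (fun e => k e - g e) = 0 := by
  have hk' : ∀ e, k (G.black⁻¹ e) = k e := fun e => by simpa using (hk (G.black⁻¹ e)).symm
  have hg' : ∀ e, g (G.black⁻¹ e) = g (G.facePerm e) := fun e => by
    rw [← G.white_facePerm, hg]
  have h1 := Equiv.sum_comp G.facePerm fun e => (2 * X e + χ (G.white e)) * g e
  have h2 := Equiv.sum_comp G.black⁻¹ fun e => k e * χ e
  have h3 := Equiv.sum_comp G.white fun e => g e * χ e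
  simp only [hk', hg, white_facePerm] at h1 h2 h3
  -- Summation by parts: each of the three differences vanishes by reindexing along one of the
  -- rotations, around black nodes, faces and white nodes.
  have h4 : G.cup X χ (fun e => k e - g e) =
      (∑ e, k e * χ (G.black⁻¹ e) - ∑ e, k e * χ e) +
      (∑ e, (2 * X (G.facePerm e) + χ (G.black⁻¹ e)) * g (G.facePerm e) -
        ∑ e, (2 * X e + χ (G.white e)) * g e) +
      (∑ e, g e * χ (G.white e) - ∑ e, g e * χ e) := by
    rw [cup_apply]
    simp only [← Finset.sum_sub_distrib, ← Finset.sum_add_distrib]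
    refine Finset.sum_congr rfl fun e _ => ?_
    simp only [hk', hg', hX]
    ring
  rw [h4, h1, h2, h3]; ring

include hX in
/-- The cup product with another cochain that has a potential on each face is given by the areas
of the unfolded faces. -/
theorem cup_eq_area {Y ψ : E → ℚ} (hY : ∀ e, Y (G.facePerm e) = Y e + ψ e - ψ (G.black⁻¹ e)) :
    G.cup X χ ψ = ∑ e, ((X e * (Y e + ψ e) - Y e * (X e + χ e)) +
      ((X e + χ e) * Y (G.facePerm e) - (Y e + ψ e) * X (G.facePerm e))) := by
  -- The two sides differ by the total change of `X * Y` around the faces, which is zero.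
  have h := Equiv.sum_comp G.facePerm fun e => X e * Y e
  rw [cup_apply, ← sub_eq_zero, ← sub_eq_zero.2 h, ← Finset.sum_sub_distrib,
    ← Finset.sum_sub_distrib]
  refine Finset.sum_congr rfl fun e _ => ?_
  rw [hX, hY]; ring

open Classical in
/-- The number of times that a zigzag path runs through an edge: a cocycle, Poincaré dual to the
zigzag path. -/
def zigzagCochain (Z : G.Zigzag) (e : E) : ℤ :=
  (if G.zigzagToWhite e = Z then 1 else 0) + if G.zigzagToBlack e = Z then 1 else 0

-- Poincaré duality: the product with the dual cocycle is, up to sign, the integral of `χ` along the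
-- zigzag path. The factor 2 comes from the doubled normalisation of `cup`.
open Classical in
include hX in
theorem cup_zigzagCochain (Z : G.Zigzag) :
    G.cup X χ (fun e => (G.zigzagCochain Z e : ℚ)) = 2 *
      ∑ e ∈ Finset.univ.filter (fun e => G.zigzagToWhite e = Z), (χ e - χ (G.white e)) := by
  set k : E → ℚ := fun e => if G.zigzagToWhite e = Z then 1 else 0 with hk
  have hτ : ∀ e, k (G.zigzagPerm e) = k e := fun e => by
    simp only [hk, zigzagToWhite_zigzagPerm]
  have hφ : ∀ e, (G.zigzagCochain Z e : ℚ) = k e + k (G.white⁻¹ e) := fun e => by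
    simp only [zigzagCochain, hk]; push_cast; rfl
  have hb : ∀ e, k (G.black⁻¹ e) = k (G.white⁻¹ e) := fun e => by
    rw [← hτ (G.white⁻¹ e)]; simp [zigzagPerm]
  have hf : ∀ e, k (G.white⁻¹ (G.black⁻¹ e)) = k (G.facePerm e) := fun e => rfl
  have h1 := Equiv.sum_comp G.facePerm fun e => (2 * X e + χ (G.white e)) * k e
  have h2 := Equiv.sum_comp G.white fun e => k (G.white⁻¹ e) * (χ (G.black⁻¹ e) - χ e)
  have h3 := Equiv.sum_comp G.zigzagPerm fun e => k e * χ e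
  have hww : ∀ e, G.white⁻¹ (G.white e) = e := fun e => by simp
  simp only [white_facePerm, hτ, hww] at h1 h2 h3
  have h5 : ∀ e, χ (G.black⁻¹ (G.white e)) = χ (G.zigzagPerm e) := fun e => rfl
  simp only [h5] at h2
  have h4 : G.cup X χ (fun e => (G.zigzagCochain Z e : ℚ)) =
      ∑ e, k e * (χ e - χ (G.white e)) -
      (∑ e, (2 * X (G.facePerm e) + χ (G.black⁻¹ e)) * k (G.facePerm e) -
        ∑ e, (2 * X e + χ (G.white e)) * k e) +
      ∑ e, k (G.white⁻¹ e) * (χ (G.black⁻¹ e) - χ e) := by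
    rw [cup_apply]
    simp only [← Finset.sum_sub_distrib, ← Finset.sum_add_distrib]
    refine Finset.sum_congr rfl fun e _ => ?_
    simp only [hφ, hb, hf, hX]
    ring
  have h6 : ∑ e, k e * (χ (G.zigzagPerm e) - χ (G.white e)) = ∑ e, k e * (χ e - χ (G.white e)) := by
    simp only [mul_sub, Finset.sum_sub_distrib, h3]
  rw [h4, h1, ← h2, h6, Finset.sum_filter]
  have h7 : ∀ e, (if G.zigzagToWhite e = Z then χ e - χ (G.white e) else 0) =
      k e * (χ e - χ (G.white e)) := fun e => by simp only [hk, ite_mul, one_mul, zero_mul]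
  simp only [h7]
  ring

open Classical in
/-- The sum of a cochain over the boundary of each face. -/
def faceMatrix : Matrix G.Face E ℚ := Matrix.of fun f e =>
  (if (Quotient.mk _ e : G.Face) = f then 1 else 0) -
    if (Quotient.mk _ (G.black e) : G.Face) = f then 1 else 0

open Classical in
theorem faceMatrix_mulVec (φ : E → ℚ) (f : G.Face) :
    (G.faceMatrix.mulVec φ) f =
      ∑ e ∈ Finset.univ.filter (fun e => (Quotient.mk _ e : G.Face) = f),
        (φ e - φ (G.black⁻¹ e)) := by
  have h := Equiv.sum_comp G.black
    fun e => if (Quotient.mk _ e : G.Face) = f then φ (G.black⁻¹ e) else 0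
  have hbb : ∀ e, G.black⁻¹ (G.black e) = e := fun e => by simp
  simp only [hbb] at h
  simp only [Matrix.mulVec, dotProduct, faceMatrix, Matrix.of_apply, sub_mul, ite_mul, one_mul,
    zero_mul, Finset.sum_sub_distrib]
  rw [h, Finset.sum_filter, Finset.sum_filter]

/-- A function on the faces in the kernel of the transpose takes equal values on both sides of every
edge, so by connectedness it is constant. -/
theorem card_le_rank_faceMatrix_add_one
    (hG : MulAction.IsPretransitive (Subgroup.closure {G.white, G.black}) E) :
    Fintype.card G.Face ≤ G.faceMatrix.rank + 1 := by
  classical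
  rw [← Matrix.rank_transpose, Matrix.rank]
  have hrn := LinearMap.finrank_range_add_finrank_ker (G.faceMatrix.transpose.mulVecLin)
  rw [Module.finrank_fintype_fun_eq_card] at hrn
  rw [← hrn]
  refine Nat.add_le_add_left ?_ _
  have hker : G.faceMatrix.transpose.mulVecLin.ker ≤ Submodule.span ℚ {(fun _ => 1)} := by
    intro s hs
    have hs' : ∀ e, s (Quotient.mk _ e) = s (Quotient.mk _ (G.black e)) := by
      intro e
      have := congrFun (LinearMap.mem_ker.1 hs) e
      simp only [Matrix.mulVecLin_apply, Matrix.mulVec, dotProduct, Matrix.transpose_apply,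
        faceMatrix, Matrix.of_apply, sub_mul, ite_mul, one_mul, zero_mul,
        Finset.sum_sub_distrib, Finset.sum_ite_eq, Finset.mem_univ, if_true, Pi.zero_apply] at this
      exact sub_eq_zero.1 this
    have hface : ∀ e, s (Quotient.mk _ (G.facePerm e)) = s (Quotient.mk _ e) := fun e => by
      rw [G.facePerm.mk_apply]
    have hwhite : ∀ e, s (Quotient.mk _ (G.white e)) = s (Quotient.mk _ e) := by
      intro e
      have h1 := hface (G.black (G.white e))
      have h2 : G.facePerm (G.black (G.white e)) = e := by simp [facePerm]
      rw [h2] at h1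
      rw [h1, ← hs']
    rw [Submodule.mem_span_singleton]
    by_cases hne : Nonempty E
    · obtain ⟨e₀⟩ := hne
      refine ⟨s (Quotient.mk _ e₀), funext fun f => ?_⟩
      induction f using Quotient.inductionOn with
      | h e =>
        simpa using G.eq_of_connected hG (k := fun e => s (Quotient.mk _ e)) hwhite
          (fun e => (hs' e).symm) e₀ e
    · refine ⟨0, funext fun f => ?_⟩
      exact (hne ⟨f.out⟩).elim
  exact (Submodule.finrank_mono hker).trans ((finrank_span_le_card _).trans (by simp))

end Finite

end BipartiteMap

/-! ### The first cohomology of the torus and the classes of zigzag paths -/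

namespace TorusDimer

open BipartiteMap

variable {E : Type*} [Fintype E] (D : TorusDimer E)

theorem nonempty_edges {E : Type*} [Fintype E] (D : TorusDimer E) : Nonempty E := by
  by_contra h
  have : IsEmpty D.Face := ⟨fun f => h ⟨f.out⟩⟩
  simpa using D.weight_degree

/-- The coordinates of the weight have potentials on each face, for which their cup product
is `2`. -/
theorem exists_weight_potential : ∃ X Y : E → ℚ,
    (∀ e, X (D.facePerm e) = X e + ((D.weight e).1 : ℚ) - ((D.weight (D.black⁻¹ e)).1 : ℚ)) ∧
    (∀ e, Y (D.facePerm e) = Y e + ((D.weight e).2 : ℚ) - ((D.weight (D.black⁻¹ e)).2 : ℚ)) ∧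
    D.cup X (fun e => ((D.weight e).1 : ℚ)) (fun e => ((D.weight e).2 : ℚ)) = 2 ∧
    D.cup Y (fun e => ((D.weight e).2 : ℚ)) (fun e => ((D.weight e).1 : ℚ)) = -2 := by
  obtain ⟨P, hP, hA⟩ := D.exists_face_potential D.weight D.weight_face
  have hX : ∀ e, ((P (D.facePerm e)).1 : ℚ) =
      (P e).1 + ((D.weight e).1 : ℚ) - ((D.weight (D.black⁻¹ e)).1 : ℚ) := fun e => by
    rw [hP]; simp
  have hY : ∀ e, ((P (D.facePerm e)).2 : ℚ) =
      (P e).2 + ((D.weight e).2 : ℚ) - ((D.weight (D.black⁻¹ e)).2 : ℚ) := fun e => by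
    rw [hP]; simp
  rw [D.weight_degree] at hA
  have hA' : (2 : ℚ) = ∑ e, ((wedge (P e) (P e + D.weight e) +
      wedge (P e + D.weight e) (P (D.facePerm e)) : ℤ) : ℚ) := by
    exact_mod_cast hA
  refine ⟨fun e => (P e).1, fun e => (P e).2, hX, hY, ?_, ?_⟩
  · rw [D.cup_eq_area (X := fun e => ((P e).1 : ℚ)) (Y := fun e => ((P e).2 : ℚ)) hX hY, hA']
    refine Finset.sum_congr rfl fun e _ => ?_
    simp only [wedge, Prod.fst_add, Prod.snd_add]
    push_cast
    ring
  · rw [D.cup_eq_area (X := fun e => ((P e).2 : ℚ)) (Y := fun e => ((P e).1 : ℚ)) hY hX, hA',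
      ← Finset.sum_neg_distrib]
    refine Finset.sum_congr rfl fun e _ => ?_
    simp only [wedge, Prod.fst_add, Prod.snd_add]
    push_cast
    ring

/-- The cochain given by a potential on the nodes and a combination of the weights. -/
def cochainMap : ((D.WhiteNode → ℚ) × (D.BlackNode → ℚ)) × (ℚ × ℚ) →ₗ[ℚ] (E → ℚ) where
  toFun p e := p.1.2 (D.blackEnd e) - p.1.1 (D.whiteEnd e) +
    (p.2.1 * (D.weight e).1 + p.2.2 * (D.weight e).2)
  map_add' p q := by
    funext e; simp only [Prod.fst_add, Prod.snd_add, Pi.add_apply]; ring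
  map_smul' c p := by
    funext e
    simp only [Prod.smul_fst, Prod.smul_snd, Pi.smul_apply, smul_eq_mul, RingHom.id_apply]; ring

theorem cochainMap_eq (p : ((D.WhiteNode → ℚ) × (D.BlackNode → ℚ)) × (ℚ × ℚ)) :
    D.cochainMap p = (fun e => p.1.2 (D.blackEnd e) - p.1.1 (D.whiteEnd e)) +
      (p.2.1 • (fun e => ((D.weight e).1 : ℚ)) + p.2.2 • (fun e => ((D.weight e).2 : ℚ))) := rfl

/-- Coboundaries and self-products drop out, so the products with the two weights read off the
coefficients of a cochain. -/
theorem cup_cochainMap {X Y : E → ℚ}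
    (hX : ∀ e, X (D.facePerm e) = X e + ((D.weight e).1 : ℚ) - ((D.weight (D.black⁻¹ e)).1 : ℚ))
    (hY : ∀ e, Y (D.facePerm e) = Y e + ((D.weight e).2 : ℚ) - ((D.weight (D.black⁻¹ e)).2 : ℚ))
    (hXY : D.cup X (fun e => ((D.weight e).1 : ℚ)) (fun e => ((D.weight e).2 : ℚ)) = 2)
    (hYX : D.cup Y (fun e => ((D.weight e).2 : ℚ)) (fun e => ((D.weight e).1 : ℚ)) = -2)
    (p : ((D.WhiteNode → ℚ) × (D.BlackNode → ℚ)) × (ℚ × ℚ)) :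
    D.cup X (fun e => ((D.weight e).1 : ℚ)) (D.cochainMap p) = 2 * p.2.2 ∧
    D.cup Y (fun e => ((D.weight e).2 : ℚ)) (D.cochainMap p) = -2 * p.2.1 := by
  have h : ∀ {X χ : E → ℚ}, (∀ e, X (D.facePerm e) = X e + χ e - χ (D.black⁻¹ e)) →
      D.cup X χ (fun e => p.1.2 (D.blackEnd e) - p.1.1 (D.whiteEnd e)) = 0 := fun hX =>
    D.cup_coboundary hX (g := fun e => p.1.1 (D.whiteEnd e)) (k := fun e => p.1.2 (D.blackEnd e))
      (fun e => by simp) (fun e => by simp)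
  constructor
  · rw [cochainMap_eq, map_add, map_add, map_smul, map_smul, h hX, D.cup_self hX, hXY]
    simp [mul_comm]
  · rw [cochainMap_eq, map_add, map_add, map_smul, map_smul, h hY, D.cup_self hY, hYX]
    simp [mul_comm]

/-- The cup products force both coefficients of the weights to be zero. What is left is a potential
that agrees at the two ends of each edge, hence a constant. -/
theorem finrank_ker_cochainMap_le : Module.finrank ℚ D.cochainMap.ker ≤ 1 := by
  obtain ⟨X, Y, hX, hY, hXY, hYX⟩ := D.exists_weight_potential
  obtain ⟨e₀⟩ := D.nonempty_edges
  have hker : D.cochainMap.ker ≤ Submodule.span ℚ {((fun _ => 1, fun _ => 1), (0, 0))} := by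
    intro p hp
    have h := D.cup_cochainMap hX hY hXY hYX p
    rw [LinearMap.mem_ker.1 hp, map_zero, map_zero] at h
    have h1 : p.2.1 = 0 := by linarith [h.2]
    have h2 : p.2.2 = 0 := by linarith [h.1]
    have h3 : ∀ e, p.1.2 (D.blackEnd e) = p.1.1 (D.whiteEnd e) := by
      intro e
      have := congrFun (LinearMap.mem_ker.1 hp) e
      simp only [cochainMap_eq, h1, h2, Pi.add_apply, zero_smul, Pi.zero_apply, add_zero] at this
      exact sub_eq_zero.1 this
    have h4 := D.eq_of_connected D.connected (k := fun e => p.1.1 (D.whiteEnd e)) (fun e => by simp)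
      (fun e => by rw [← h3, ← h3, blackEnd_black])
    rw [Submodule.mem_span_singleton]
    refine ⟨p.1.1 (D.whiteEnd e₀), ?_⟩
    refine Prod.ext (Prod.ext (funext fun v => ?_) (funext fun v => ?_)) (Prod.ext ?_ ?_)
    · induction v using Quotient.inductionOn with
      | h e => exact (mul_one _).trans (h4 e₀ e)
    · induction v using Quotient.inductionOn with
      | h e => exact (mul_one _).trans ((h4 e₀ e).trans (h3 e).symm)
    · simp [h1]
    · simp [h2]
  exact (Submodule.finrank_mono hker).trans ((finrank_span_le_card _).trans (by simp))

/-- A closed cochain is, up to a coboundary, a combination of the weights. -/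
theorem range_cochainMap : D.cochainMap.range = D.faceMatrix.mulVecLin.ker := by
  classical
  refine Submodule.eq_of_le_of_finrank_le ?_ ?_
  · rintro _ ⟨p, rfl⟩
    refine LinearMap.mem_ker.2 (funext fun f => ?_)
    rw [Matrix.mulVecLin_apply, faceMatrix_mulVec]
    have hw : ∀ e, D.whiteEnd (D.black⁻¹ e) = D.whiteEnd (D.facePerm e) := fun e => by
      rw [← D.white_facePerm, whiteEnd_white]
    have hf := D.weight_face f
    rw [faceSum] at hf
    have hf1 : (∑ e ∈ Finset.univ.filter (fun e => (Quotient.mk _ e : D.Face) = f),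
        (((D.weight e).1 : ℚ) - (D.weight (D.black⁻¹ e)).1)) = 0 := by
      have := congrArg Prod.fst hf
      rw [Prod.fst_sum] at this
      exact_mod_cast this
    have hf2 : (∑ e ∈ Finset.univ.filter (fun e => (Quotient.mk _ e : D.Face) = f),
        (((D.weight e).2 : ℚ) - (D.weight (D.black⁻¹ e)).2)) = 0 := by
      have := congrArg Prod.snd hf
      rw [Prod.snd_sum] at this
      exact_mod_cast this
    have hf3 : (∑ e ∈ Finset.univ.filter (fun e => (Quotient.mk _ e : D.Face) = f),
        (p.1.1 (D.whiteEnd (D.facePerm e)) - p.1.1 (D.whiteEnd e))) = 0 := by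
      have h := Equiv.sum_comp D.facePerm
        fun e => if (Quotient.mk _ e : D.Face) = f then p.1.1 (D.whiteEnd e) else 0
      have hm : ∀ e, (Quotient.mk _ (D.facePerm e) : D.Face) = Quotient.mk _ e :=
        D.facePerm.mk_apply
      simp only [hm] at h
      rw [Finset.sum_sub_distrib, Finset.sum_filter, Finset.sum_filter, h, sub_self]
    have key : ∀ e, D.cochainMap p e - D.cochainMap p (D.black⁻¹ e) =
        (p.1.1 (D.whiteEnd (D.facePerm e)) - p.1.1 (D.whiteEnd e)) +
        p.2.1 * (((D.weight e).1 : ℚ) - (D.weight (D.black⁻¹ e)).1) +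
        p.2.2 * (((D.weight e).2 : ℚ) - (D.weight (D.black⁻¹ e)).2) := by
      intro e
      simp only [cochainMap_eq, Pi.add_apply, Pi.smul_apply, smul_eq_mul, blackEnd_black_inv, hw]
      ring
    simp only [key, Finset.sum_add_distrib, ← Finset.mul_sum, hf1, hf2, hf3, mul_zero, add_zero,
      Pi.zero_apply]
  -- Dimension count: the range has dimension at least the number of nodes plus 1, the closed
  -- cochains have dimension at most edges minus faces plus 1, and Euler's formula equates the two
  -- bounds.
  · have h1 := D.faceMatrix.mulVecLin.finrank_range_add_finrank_ker
    have h2 := D.cochainMap.finrank_range_add_finrank_ker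
    have h3 := D.finrank_ker_cochainMap_le
    have h4 := D.card_le_rank_faceMatrix_add_one D.connected
    have h5 := D.euler
    simp only [Module.finrank_prod, Module.finrank_fintype_fun_eq_card, Module.finrank_self]
      at h1 h2
    rw [Matrix.rank] at h4
    simp only [Nat.card_eq_fintype_card] at h5
    omega

open Classical in
theorem winding_fst (Z : D.Zigzag) : ((D.winding Z).1 : ℚ) =
    - ∑ e ∈ Finset.univ.filter (fun e => D.zigzagToWhite e = Z),
      (((D.weight e).1 : ℚ) - ((D.weight (D.white e)).1 : ℚ)) := by
  rw [winding, Prod.fst_sum, ← Finset.sum_neg_distrib]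
  push_cast
  exact Finset.sum_congr rfl fun e _ => by simp

open Classical in
theorem winding_snd (Z : D.Zigzag) : ((D.winding Z).2 : ℚ) =
    - ∑ e ∈ Finset.univ.filter (fun e => D.zigzagToWhite e = Z),
      (((D.weight e).2 : ℚ) - ((D.weight (D.white e)).2 : ℚ)) := by
  rw [winding, Prod.snd_sum, ← Finset.sum_neg_distrib]
  push_cast
  exact Finset.sum_congr rfl fun e _ => by simp

/-- Up to a coboundary, the number of times that a zigzag path runs through an edge is the wedge
of the weight with its winding. -/
theorem exists_zigzag_potential (Z : D.Zigzag) : ∃ g k : E → ℚ,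
    (∀ e, g (D.white e) = g e) ∧ (∀ e, k (D.black e) = k e) ∧
    ∀ e, (D.zigzagCochain Z e : ℚ) = -(wedge (D.winding Z) (D.weight e) : ℤ) + k e - g e := by
  classical
  have hmem : (fun e => (D.zigzagCochain Z e : ℚ)) ∈ D.cochainMap.range := by
    rw [range_cochainMap]
    refine LinearMap.mem_ker.2 (funext fun f => ?_)
    rw [Matrix.mulVecLin_apply, faceMatrix_mulVec]
    set k : E → ℚ := fun e => if D.zigzagToWhite e = Z then 1 else 0 with hk
    -- The path turning at the corner of the face between `e` and `black⁻¹ e` runs through both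
    -- edges and cancels; the rest telescopes around the face.
    have key : ∀ e, (D.zigzagCochain Z e : ℚ) - D.zigzagCochain Z (D.black⁻¹ e) =
        k e - k (D.facePerm e) := by
      intro e
      have h1 : D.zigzagToBlack (D.black⁻¹ e) = D.zigzagToWhite (D.facePerm e) := rfl
      simp only [zigzagCochain, h1, zigzagToWhite_black_inv, hk]
      push_cast
      ring
    have h := Equiv.sum_comp D.facePerm
      fun e => if (Quotient.mk _ e : D.Face) = f then k e else 0
    have hm : ∀ e, (Quotient.mk _ (D.facePerm e) : D.Face) = Quotient.mk _ e :=
      D.facePerm.mk_apply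
    simp only [hm] at h
    simp only [key]
    rw [Finset.sum_sub_distrib, Finset.sum_filter, Finset.sum_filter, h, sub_self, Pi.zero_apply]
  obtain ⟨p, hp⟩ := hmem
  obtain ⟨X, Y, hX, hY, hXY, hYX⟩ := D.exists_weight_potential
  -- The coefficients of the class are computed by pairing with the two weights, which by duality
  -- gives the coordinates of the winding.
  have h := D.cup_cochainMap hX hY hXY hYX p
  rw [hp, D.cup_zigzagCochain hX, D.cup_zigzagCochain hY] at h
  have h1 := D.winding_fst Z
  have h2 := D.winding_snd Z
  refine ⟨fun e => p.1.1 (D.whiteEnd e), fun e => p.1.2 (D.blackEnd e), fun e => by simp,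
    fun e => by simp, fun e => ?_⟩
  have h3 := congrFun hp e
  have h4 : p.2.2 = -(D.winding Z).1 := by linarith [h.1]
  have h5 : p.2.1 = (D.winding Z).2 := by linarith [h.2]
  rw [← h3]
  simp only [cochainMap_eq, Pi.add_apply, Pi.smul_apply, smul_eq_mul, h4, h5, wedge]
  push_cast
  ring

end TorusDimer

/-! ### Consequences of proper ordering for the windings -/

theorem wedge_eq_zero_of_common {v a b : ℤ × ℤ} (hv : v ≠ 0) (ha : wedge v a = 0)
    (hb : wedge v b = 0) : wedge a b = 0 := by
  obtain ⟨v1, v2⟩ := v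
  simp only [wedge] at *
  by_contra h
  apply hv
  have h1 : v1 * (a.1 * b.2 - a.2 * b.1) = 0 := by linear_combination a.1 * hb - b.1 * ha
  have h2 : v2 * (a.1 * b.2 - a.2 * b.1) = 0 := by linear_combination a.2 * hb - b.2 * ha
  rw [mul_eq_zero, or_iff_left h] at h1 h2
  rw [h1, h2]; rfl

theorem wedge_sum {ι : Type*} (s : Finset ι) (v : ℤ × ℤ) (f : ι → ℤ × ℤ) :
    wedge v (∑ i ∈ s, f i) = ∑ i ∈ s, wedge v (f i) := by
  simp only [wedge, Prod.fst_sum, Prod.snd_sum, Finset.mul_sum, Finset.sum_sub_distrib]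

theorem Equiv.Perm.minimalPeriod_pos {E : Type*} [Finite E] (σ : Equiv.Perm E) (e : E) :
    0 < Function.minimalPeriod σ e :=
  Function.minimalPeriod_pos_of_mem_periodicPts (Function.Injective.mem_periodicPts σ.injective e)

theorem Equiv.Perm.one_lt_minimalPeriod {E : Type*} [Finite E] (σ : Equiv.Perm E) {e : E}
    (h : σ e ≠ e) : 1 < Function.minimalPeriod σ e := by
  have h1 := σ.minimalPeriod_pos e
  have h2 : Function.minimalPeriod σ e ≠ 1 := fun h3 =>
    h (Function.minimalPeriod_eq_one_iff_isFixedPt.1 h3)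
  omega

theorem Equiv.Perm.card_le_two_mul_card_orbits {E : Type*} [Fintype E] (σ : Equiv.Perm E)
    (h : ∀ e, σ (σ e) = e) [Fintype (Quotient (Equiv.Perm.SameCycle.setoid σ))] :
    Fintype.card E ≤ 2 * Fintype.card (Quotient (Equiv.Perm.SameCycle.setoid σ)) := by
  classical
  have h1 := Finset.card_le_mul_card_image_of_maps_to
    (f := fun e : E => Quotient.mk (Equiv.Perm.SameCycle.setoid σ) e) (s := Finset.univ)
    (t := Finset.univ) (fun _ _ => Finset.mem_univ _) 2 ?_
  · simpa using h1
  · intro b _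
    obtain ⟨x, rfl⟩ := Quotient.exists_rep b
    refine (Finset.card_le_card (t := {x, σ x}) ?_).trans Finset.card_le_two
    intro e he
    simp only [Finset.mem_filter, Finset.mem_univ, true_and] at he
    obtain ⟨i, hi, hie⟩ := σ.exists_pow_of_mk_eq x e he
    have h2 : Function.minimalPeriod σ x ≤ 2 :=
      Function.IsPeriodicPt.minimalPeriod_le (by norm_num) (h x)
    have : i = 0 ∨ i = 1 := by omega
    rcases this with rfl | rfl <;> simp [← hie]

namespace BipartiteMap

instance {E : Type*} [Fintype E] (G : BipartiteMap E) : Fintype G.Zigzag := Fintype.ofFinite _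

end BipartiteMap

namespace TorusDimer

open BipartiteMap

variable {E : Type*} [Fintype E] (D : TorusDimer E)

theorem OrderedAround.not_sameRay {rot : Equiv.Perm E} {w : E → ℤ × ℤ} {e : E}
    (h : OrderedAround rot w e) (he : rot e ≠ e) : ¬ SameRay ℤ (w e) (w (rot e)) := by
  simpa using h.2.1 1 one_pos (rot.one_lt_minimalPeriod he)

variable {D} (hD : D.ProperlyOrdered)

include hD

theorem ProperlyOrdered.winding_ne_zero (Z : D.Zigzag) : D.winding Z ≠ 0 := by
  induction Z using Quotient.inductionOn with
  | h e => exact (hD.1 e).1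

/-- If an end of `e` has valency one, both passages along `e` belong to one zigzag path. If the
other end had larger valency, this path would occur twice around it, against the distinctness of
directions. So both ends have valency one, and the path runs back and forth along `e` with winding
zero. -/
theorem ProperlyOrdered.not_fixed (e : E) : D.white e ≠ e ∧ D.black e ≠ e := by
  classical
  by_contra h
  have h1 : D.zigzagToWhite e = D.zigzagToBlack e := by
    by_cases hw : D.white e = e
    · have := D.zigzagToBlack_white e
      rwa [hw, eq_comm] at this
    · have hb : D.black e = e := by tauto
      have := D.zigzagToBlack_black e
      rwa [hb, eq_comm] at this
  have hb : D.black e = e := by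
    by_contra hb
    apply (hD.2 e).not_sameRay hb
    simp only [zigzagToBlack_black, h1]
    exact SameRay.refl _
  have hw : D.white e = e := by
    by_contra hw
    have hw' : D.white (D.white⁻¹ e) ≠ D.white⁻¹ e := fun h => hw (by simpa using congrArg D.white h)
    apply (hD.1 (D.white⁻¹ e)).not_sameRay hw'
    have h2 : D.zigzagToWhite (D.white⁻¹ e) = D.zigzagToBlack e := rfl
    simp only [Equiv.Perm.coe_inv, Equiv.apply_symm_apply] at h2 ⊢
    rw [h2, h1]
  apply hD.winding_ne_zero (D.zigzagToWhite e)
  have hτ : D.zigzagPerm e = e := by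
    rw [zigzagPerm, Equiv.Perm.mul_apply, hw, Equiv.Perm.inv_eq_iff_eq, hb]
  rw [winding]
  refine Finset.sum_eq_zero fun e' he' => ?_
  simp only [Finset.mem_filter, Finset.mem_univ, true_and] at he'
  have hs : D.zigzagPerm.SameCycle e e' := (Quotient.exact he').symm
  obtain ⟨i, hi⟩ := hs
  rw [Equiv.Perm.zpow_apply_eq_self_of_apply_eq_self hτ] at hi
  rw [← hi, hw, sub_self]

/-- The two zigzag paths of an edge are neighbours around its white endpoint. In particular no
zigzag path uses an edge twice. -/
theorem ProperlyOrdered.not_sameRay (e : E) :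
    ¬ SameRay ℤ (D.winding (D.zigzagToBlack e)) (D.winding (D.zigzagToWhite e)) := by
  have h := (hD.1 (D.white⁻¹ e)).not_sameRay (hD.not_fixed _).1
  have h2 : D.white (D.white⁻¹ e) = e := by simp
  simp only [h2] at h
  exact h

theorem ProperlyOrdered.zigzag_ne (e : E) : D.zigzagToBlack e ≠ D.zigzagToWhite e := by
  intro h
  apply hD.not_sameRay e
  rw [h]

-- Each edge is run through once in either direction, so its two contributions cancel.
omit hD in
theorem sum_winding : ∑ Z, D.winding Z = 0 := by
  classical
  simp only [winding]
  rw [Finset.sum_fiberwise (s := Finset.univ) (g := fun e : E => D.zigzagToWhite e)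
    (f := fun e => D.weight (D.white e) - D.weight e), Finset.sum_sub_distrib,
    Equiv.sum_comp D.white D.weight, sub_self]

-- Parallel vectors are never in strict counterclockwise order, so only nodes of valency at most two
-- are possible.
omit hD in
theorem OrderedAround.apply_apply {rot : Equiv.Perm E} {w : E → ℤ × ℤ} {e : E}
    (h : OrderedAround rot w e) (hw : ∀ e e', wedge (w e) (w e') = 0) : rot (rot e) = e := by
  by_contra hne
  by_cases h2 : 2 < Function.minimalPeriod rot e
  · have := h.2.2 1 2 one_pos one_lt_two h2
    simp [CcwOrdered, hw] at this
  · have h0 := rot.minimalPeriod_pos e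
    have h1 : Function.IsPeriodicPt rot 2 e := by
      rw [Function.isPeriodicPt_iff_minimalPeriod_dvd]
      have : Function.minimalPeriod rot e = 1 ∨ Function.minimalPeriod rot e = 2 := by omega
      rcases this with h | h <;> rw [h]
      norm_num
    exact hne h1

/-- The windings of the zigzag paths are not contained in a half-plane. -/
theorem ProperlyOrdered.exists_wedge_pos {v : ℤ × ℤ} (hv : v ≠ 0) :
    ∃ Z, 0 < wedge v (D.winding Z) := by
  classical
  by_contra! h
  have h0 : ∀ Z, wedge v (D.winding Z) = 0 := by
    have h1 : ∑ Z, wedge v (D.winding Z) = 0 := by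
      rw [← wedge_sum, sum_winding]; simp [wedge]
    have h2 := (Finset.sum_eq_zero_iff_of_nonpos fun Z _ => h Z).1 h1
    exact fun Z => h2 Z (Finset.mem_univ Z)
  have hww : ∀ Z Z', wedge (D.winding Z) (D.winding Z') = 0 := fun Z Z' =>
    wedge_eq_zero_of_common hv (h0 Z) (h0 Z')
  -- With valencies at most two there are at least as many nodes as edges, and Euler's formula
  -- leaves no room for a face.
  have h1 : Fintype.card E ≤ 2 * Fintype.card D.WhiteNode := D.white.card_le_two_mul_card_orbits fun e =>
    (hD.1 e).apply_apply fun _ _ => hww _ _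
  have h2 : Fintype.card E ≤ 2 * Fintype.card D.BlackNode := D.black.card_le_two_mul_card_orbits fun e =>
    (hD.2 e).apply_apply fun _ _ => hww _ _
  obtain ⟨e₀⟩ := D.nonempty_edges
  have : Nonempty D.Face := ⟨Quotient.mk _ e₀⟩
  have h3 : 0 < Fintype.card D.Face := Fintype.card_pos
  have h5 := D.euler
  simp only [Nat.card_eq_fintype_card] at h5
  omega

/-- The winding of a zigzag path is primitive. -/
theorem ProperlyOrdered.winding_ne_smul (Z : D.Zigzag) {n : ℕ} (hn : 2 ≤ n) (u : ℤ × ℤ) :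
    D.winding Z ≠ n • u := by
  classical
  intro hZ
  obtain ⟨g, k, hg, hk, hφ⟩ := D.exists_zigzag_potential Z
  obtain ⟨e₀, he₀⟩ : ∃ e, D.zigzagToWhite e = Z := Quotient.exists_rep Z
  -- The potentials are only known to be rational, but their differences are sums of integers, so
  -- they become integral after subtracting one value.
  have hint : ∀ e, ∃ z : ℤ, g e = g e₀ + z := by
    refine D.forall_of_connected D.connected (fun e => by simp only [hg]) (fun e => ?_)
      (e₀ := e₀) ⟨0, by simp⟩
    have h1 := hφ e
    have h2 := hφ (D.black e)
    rw [hk] at h2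
    constructor
    · rintro ⟨z, hz⟩
      refine ⟨z + D.zigzagCochain Z (D.black e) + wedge (D.winding Z) (D.weight (D.black e)) -
        (D.zigzagCochain Z e + wedge (D.winding Z) (D.weight e)), ?_⟩
      push_cast
      linarith
    · rintro ⟨z, hz⟩
      refine ⟨z - (D.zigzagCochain Z (D.black e) + wedge (D.winding Z) (D.weight (D.black e))) +
        (D.zigzagCochain Z e + wedge (D.winding Z) (D.weight e)), ?_⟩
      push_cast
      linarith
  choose G hG using hint
  have hGw : ∀ e, G (D.white e) = G e := fun e => by
    have := hg e
    rw [hG, hG e] at this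
    exact_mod_cast add_left_cancel this
  set K : E → ℤ := fun e => D.zigzagCochain Z e + wedge (D.winding Z) (D.weight e) + G e with hK
  have hkK : ∀ e, k e = g e₀ + K e := fun e => by
    have := hφ e
    rw [hG e] at this
    rw [hK]; push_cast; linarith
  have hKb : ∀ e, K (D.black e) = K e := fun e => by
    have := hk e
    rw [hkK, hkK e] at this
    exact_mod_cast add_left_cancel this
  have : Fact (1 < n) := ⟨hn⟩
  -- Modulo `n` the wedge with the winding disappears, so the zigzag cochain is a coboundary modulo
  -- `n`.
  have hmod : ∀ e, (K e : ZMod n) = D.zigzagCochain Z e + G e := fun e => by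
    have : wedge (n • u) (D.weight e) = n * wedge u (D.weight e) := by
      simp only [wedge, Prod.smul_fst, Prod.smul_snd]; simp only [nsmul_eq_mul]; ring
    simp only [hK, hZ, this]
    push_cast
    simp
  have hφW : ∀ e, D.zigzagToWhite e = Z → D.zigzagCochain Z e = 1 := fun e he => by
    have := hD.zigzag_ne e
    rw [he] at this
    simp [zigzagCochain, he, this]
  have hφB : ∀ e, D.zigzagToBlack e = Z → D.zigzagCochain Z e = 1 := fun e he => by
    have := hD.zigzag_ne e
    rw [he] at this
    simp [zigzagCochain, he, this.symm]
  have hGW : ∀ e, D.zigzagToWhite e = Z → (G e : ZMod n) = G e₀ := by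
    intro e he
    have hs : D.zigzagPerm.SameCycle e e₀ := Quotient.exact (he.trans he₀.symm)
    have := D.zigzagPerm.lift_of_invariant
      (fun e => if D.zigzagToWhite e = Z then (G e : ZMod n) else 0) (fun e => ?_) hs
    · simpa [he, he₀] using this
    · simp only [zigzagToWhite_zigzagPerm]
      by_cases h : D.zigzagToWhite e = Z
      · simp only [h, if_true]
        have h1 := hmod (D.white e)
        have h2 := hmod (D.zigzagPerm e)
        have h3 : D.black (D.zigzagPerm e) = D.white e := by simp [zigzagPerm]
        rw [← hKb, h3, h1, hφB _ (by simpa using h), hGw, hφW _ (by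
          rw [zigzagToWhite_zigzagPerm, h])] at h2
        exact (add_left_cancel h2).symm
      · simp [h]
  have hGB : ∀ e, D.zigzagToBlack e = Z → (G e : ZMod n) = G e₀ := by
    intro e he
    have h1 := hGw (D.white⁻¹ e)
    have h2 : D.white (D.white⁻¹ e) = e := by simp
    rw [h2] at h1
    rw [h1, hGW _ he]
  have hcase : ∀ e, (D.zigzagCochain Z e = 1 ∧ (G e : ZMod n) = G e₀ ∧ (K e : ZMod n) = G e₀ + 1) ∨
      (D.zigzagCochain Z e = 0 ∧ (K e : ZMod n) = G e) := by
    intro e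
    by_cases h1 : D.zigzagToWhite e = Z
    · left; refine ⟨hφW e h1, hGW e h1, ?_⟩
      rw [hmod, hφW e h1, hGW e h1]; push_cast; ring
    · by_cases h2 : D.zigzagToBlack e = Z
      · left; refine ⟨hφB e h2, hGB e h2, ?_⟩
        rw [hmod, hφB e h2, hGB e h2]; push_cast; ring
      · right
        have h3 : D.zigzagCochain Z e = 0 := by simp [zigzagCochain, h1, h2]
        refine ⟨h3, ?_⟩
        rw [hmod, h3]; push_cast; ring
  have hne : (G e₀ : ZMod n) + 1 ≠ G e₀ := by simp
  have hGK : ∀ e, ((G e : ZMod n) = G e₀ ∨ (G e : ZMod n) = G e₀ + 1) ↔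
      ((K e : ZMod n) = G e₀ ∨ (K e : ZMod n) = G e₀ + 1) := by
    intro e
    rcases hcase e with ⟨-, h1, h2⟩ | ⟨-, h1⟩
    · simp [h1, h2]
    · rw [h1]
  -- The residue changes only across edges of `Z`, and always between the same two values. Replacing
  -- these two residues by 0 and 1 gives an integral potential, so the zigzag cochain is a genuine
  -- coboundary and the winding is zero, a contradiction.
  have hall : ∀ e, (G e : ZMod n) = G e₀ ∨ (G e : ZMod n) = G e₀ + 1 :=
    D.forall_of_connected D.connected (fun e => by rw [hGw]) (fun e => by rw [hGK, hKb, ← hGK])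
      (e₀ := e₀) (Or.inl rfl)
  have hexact : (fun e => (D.zigzagCochain Z e : ℚ)) = fun e =>
      (if (K e : ZMod n) = G e₀ then (0 : ℚ) else 1) - if (G e : ZMod n) = G e₀ then 0 else 1 := by
    funext e
    rcases hcase e with ⟨h0, h1, h2⟩ | ⟨h0, h1⟩
    · simp [h0, h1, h2]
    · simp [h0, h1]
  obtain ⟨X, Y, hX, hY, -, -⟩ := D.exists_weight_potential
  have h1 := D.cup_zigzagCochain hX Z
  have h2 := D.cup_zigzagCochain hY Z
  rw [hexact, D.cup_coboundary hX (by simp [hGw]) (by simp [hKb])] at h1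
  rw [hexact, D.cup_coboundary hY (by simp [hGw]) (by simp [hKb])] at h2
  have h3 := D.winding_fst Z
  have h4 := D.winding_snd Z
  apply hD.winding_ne_zero Z
  refine Prod.ext ?_ ?_
  · have : ((D.winding Z).1 : ℚ) = 0 := by linarith
    exact_mod_cast this
  · have : ((D.winding Z).2 : ℚ) = 0 := by linarith
    exact_mod_cast this

end TorusDimer

/-! ### Angles of lattice vectors -/

/-- The complex number `-v / u`, up to a positive factor. -/
def relComplex (u v : ℤ × ℤ) : ℂ :=
  ⟨-(u.1 * v.1 + u.2 * v.2), -(u.1 * v.2 - u.2 * v.1)⟩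

/-- The angle from `-u` to `v`, in the interval from `-π` (exclusive) to `π`, so that `u` comes
last when one turns counterclockwise. -/
def relAngle (u v : ℤ × ℤ) : ℝ := Complex.arg (relComplex u v)

theorem relComplex_ne_zero {u v : ℤ × ℤ} (hu : u ≠ 0) (hv : v ≠ 0) : relComplex u v ≠ 0 := by
  intro h
  obtain ⟨u1, u2⟩ := u
  obtain ⟨v1, v2⟩ := v
  have h1 := congrArg Complex.re h
  have h2 := congrArg Complex.im h
  simp only [relComplex, Complex.zero_re, Complex.zero_im] at h1 h2
  have h1' : u1 * v1 + u2 * v2 = 0 := by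
    have : (u1 : ℝ) * v1 + u2 * v2 = 0 := by linarith
    exact_mod_cast this
  have h2' : u1 * v2 - u2 * v1 = 0 := by
    have : (u1 : ℝ) * v2 - u2 * v1 = 0 := by linarith
    exact_mod_cast this
  have hn : (u1 ^ 2 + u2 ^ 2) * (v1 ^ 2 + v2 ^ 2) = 0 := by
    linear_combination (u1 * v1 + u2 * v2) * h1' + (u1 * v2 - u2 * v1) * h2'
  rcases mul_eq_zero.1 hn with h | h
  · apply hu; ext <;> simp only [Prod.fst_zero, Prod.snd_zero] <;> nlinarith
  · apply hv; ext <;> simp only [Prod.fst_zero, Prod.snd_zero] <;> nlinarith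

theorem relAngle_mem (u v : ℤ × ℤ) : -Real.pi < relAngle u v ∧ relAngle u v ≤ Real.pi :=
  ⟨Complex.neg_pi_lt_arg _, Complex.arg_le_pi _⟩

/-- The wedge and the dot product of two vectors, in terms of their angles. -/
theorem exists_wedge_eq_sin {u a b : ℤ × ℤ} (hu : u ≠ 0) (ha : a ≠ 0) (hb : b ≠ 0) :
    ∃ r : ℝ, 0 < r ∧ (wedge a b : ℝ) = r * Real.sin (relAngle u b - relAngle u a) ∧
      ((a.1 * b.1 + a.2 * b.2 : ℤ) : ℝ) = r * Real.cos (relAngle u b - relAngle u a) := by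
  have hA := norm_pos_iff.2 (relComplex_ne_zero hu ha)
  have hB := norm_pos_iff.2 (relComplex_ne_zero hu hb)
  have hN : 0 < (u.1 : ℝ) ^ 2 + (u.2 : ℝ) ^ 2 := by
    rcases eq_or_ne u.1 0 with h1 | h1
    · have h2 : u.2 ≠ 0 := fun h2 => hu (Prod.ext h1 h2)
      have : (u.2 : ℝ) ≠ 0 := by exact_mod_cast h2
      positivity
    · have : (u.1 : ℝ) ≠ 0 := by exact_mod_cast h1
      positivity
  refine ⟨‖relComplex u a‖ * ‖relComplex u b‖ / ((u.1 : ℝ) ^ 2 + (u.2 : ℝ) ^ 2), by positivity, ?_⟩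
  have h1 := Complex.norm_mul_cos_arg (relComplex u a)
  have h2 := Complex.norm_mul_sin_arg (relComplex u a)
  have h3 := Complex.norm_mul_cos_arg (relComplex u b)
  have h4 := Complex.norm_mul_sin_arg (relComplex u b)
  rw [Real.sin_sub, Real.cos_sub]
  simp only [relAngle]
  set A := ‖relComplex u a‖
  set B := ‖relComplex u b‖
  simp only [relComplex] at h1 h2 h3 h4
  constructor
  · rw [div_mul_eq_mul_div, eq_div_iff hN.ne']
    have : A * B * (Real.sin (relComplex u b).arg * Real.cos (relComplex u a).arg -
        Real.cos (relComplex u b).arg * Real.sin (relComplex u a).arg) =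
        (B * Real.sin (relComplex u b).arg) * (A * Real.cos (relComplex u a).arg) -
        (B * Real.cos (relComplex u b).arg) * (A * Real.sin (relComplex u a).arg) := by ring
    rw [this]
    simp only [relComplex]
    rw [h1, h2, h3, h4, wedge]
    push_cast
    ring
  · rw [div_mul_eq_mul_div, eq_div_iff hN.ne']
    have : A * B * (Real.cos (relComplex u b).arg * Real.cos (relComplex u a).arg +
        Real.sin (relComplex u b).arg * Real.sin (relComplex u a).arg) =
        (B * Real.cos (relComplex u b).arg) * (A * Real.cos (relComplex u a).arg) +
        (B * Real.sin (relComplex u b).arg) * (A * Real.sin (relComplex u a).arg) := by ring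
    rw [this]
    simp only [relComplex]
    rw [h1, h2, h3, h4]
    push_cast
    ring

theorem relAngle_self {u : ℤ × ℤ} (hu : u ≠ 0) : relAngle u u = Real.pi := by
  rw [relAngle, Complex.arg_eq_pi_iff]
  constructor
  · have h : relComplex u u ≠ 0 := relComplex_ne_zero hu hu
    simp only [relComplex] at h ⊢
    by_contra h'
    apply h
    apply Complex.ext
    · simp only [Complex.zero_re]
      nlinarith [mul_self_nonneg (u.1 : ℝ), mul_self_nonneg (u.2 : ℝ)]
    · simp only [Complex.zero_im]; ring
  · simp only [relComplex]; ring

/-- A positive wedge means that the angle from `a` to `b` is between `0` and `π`. -/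
theorem wedge_pos_iff {u a b : ℤ × ℤ} (hu : u ≠ 0) (ha : a ≠ 0) (hb : b ≠ 0) :
    0 < wedge a b ↔
      (0 < relAngle u b - relAngle u a ∧ relAngle u b - relAngle u a < Real.pi) ∨
      relAngle u b - relAngle u a < -Real.pi := by
  obtain ⟨r, hr, h, -⟩ := exists_wedge_eq_sin hu ha hb
  have hA := relAngle_mem u a
  have hB := relAngle_mem u b
  set δ := relAngle u b - relAngle u a with hδ
  have h0 : 0 < wedge a b ↔ 0 < Real.sin δ := by
    rw [← Int.cast_pos (R := ℝ), h]
    exact mul_pos_iff_of_pos_left hr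
  rw [h0]
  constructor
  · intro hs
    by_contra! hc
    rcases lt_or_ge 0 δ with h1 | h1
    · have h2 := hc.1 h1
      have h3 : Real.sin (δ - 2 * Real.pi) ≤ 0 :=
        Real.sin_nonpos_of_nonpos_of_neg_pi_le (by linarith) (by linarith)
      rw [Real.sin_sub_two_pi] at h3
      linarith
    · have := Real.sin_nonpos_of_nonpos_of_neg_pi_le h1 hc.2
      linarith
  · rintro (⟨h1, h2⟩ | h1)
    · exact Real.sin_pos_of_pos_of_lt_pi h1 h2
    · rw [← Real.sin_add_two_pi]
      exact Real.sin_pos_of_pos_of_lt_pi (by linarith) (by linarith)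

theorem sameRay_of_relAngle_eq {u a b : ℤ × ℤ} (hu : u ≠ 0) (ha : a ≠ 0) (hb : b ≠ 0)
    (h : relAngle u a = relAngle u b) : wedge a b = 0 ∧ 0 < a.1 * b.1 + a.2 * b.2 ∧
      SameRay ℤ a b := by
  obtain ⟨r, hr, h1, h2⟩ := exists_wedge_eq_sin hu ha hb
  rw [h, sub_self, Real.sin_zero, mul_zero] at h1
  rw [h, sub_self, Real.cos_zero, mul_one] at h2
  have h1' : wedge a b = 0 := by exact_mod_cast h1
  have h2' : 0 < a.1 * b.1 + a.2 * b.2 := by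
    rw [← Int.cast_pos (R := ℝ), h2]; exact hr
  refine ⟨h1', h2', Or.inr (Or.inr ⟨_, a.1 * a.1 + a.2 * a.2, h2', ?_, ?_⟩)⟩
  · obtain ⟨r, hr, -, h2⟩ := exists_wedge_eq_sin hu ha ha
    rw [sub_self, Real.cos_zero, mul_one] at h2
    rw [← Int.cast_pos (R := ℝ), h2]; exact hr
  · simp only [wedge] at h1'
    ext
    · simp only [Prod.smul_fst, smul_eq_mul]; linear_combination a.2 * h1'
    · simp only [Prod.smul_snd, smul_eq_mul]; linear_combination -a.1 * h1'

/-- If `u` is primitive then the vectors with the direction of `u` are multiples of `u`. -/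
theorem exists_nsmul_of_relAngle_eq_pi {u v : ℤ × ℤ} (hu : IsCoprime u.1 u.2) (hu0 : u ≠ 0)
    (hv : v ≠ 0) (h : relAngle u v = Real.pi) : ∃ n : ℕ, 0 < n ∧ v = n • u := by
  obtain ⟨h1, h2, -⟩ := sameRay_of_relAngle_eq hu0 hu0 hv ((relAngle_self hu0).trans h.symm)
  obtain ⟨x, y, hxy⟩ := hu
  simp only [wedge] at h1
  have e1 : v.1 = (x * v.1 + y * v.2) * u.1 := by linear_combination (-v.1) * hxy - y * h1
  have e2 : v.2 = (x * v.1 + y * v.2) * u.2 := by linear_combination (-v.2) * hxy + x * h1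
  have hn : 0 < x * v.1 + y * v.2 := by
    have : u.1 * v.1 + u.2 * v.2 = (x * v.1 + y * v.2) * (u.1 * u.1 + u.2 * u.2) := by
      linear_combination u.1 * e1 + u.2 * e2
    rw [this] at h2
    exact pos_of_mul_pos_left h2 (by nlinarith [mul_self_nonneg u.1, mul_self_nonneg u.2])
  lift x * v.1 + y * v.2 to ℕ using hn.le with n hn'
  refine ⟨n, by exact_mod_cast hn, ?_⟩
  ext
  · rw [Prod.smul_fst, nsmul_eq_mul]; exact e1
  · rw [Prod.smul_snd, nsmul_eq_mul]; exact e2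

/-- A counterclockwise order is the order of the angles, starting with the least. -/
theorem CcwOrdered.relAngle_lt {u a b c : ℤ × ℤ} (hu : u ≠ 0) (ha : a ≠ 0) (hb : b ≠ 0)
    (hc : c ≠ 0) (h : CcwOrdered a b c) (hab : relAngle u a ≤ relAngle u b)
    (hac : relAngle u a ≤ relAngle u c) : relAngle u b < relAngle u c := by
  have hA := relAngle_mem u a
  have hB := relAngle_mem u b
  have hC := relAngle_mem u c
  rw [CcwOrdered, wedge_pos_iff hu ha hb, wedge_pos_iff hu hb hc, wedge_pos_iff hu hc ha] at h
  by_contra! hbc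
  rcases h with ⟨h1 | h1, h2 | h2⟩ | ⟨h1 | h1, h2 | h2⟩ | ⟨h1 | h1, h2 | h2⟩ <;> linarith

open TorusDimer in
/-- Around a node, the angle decreases exactly once. -/
theorem existsUnique_descent {E : Type*} [Fintype E] {rot : Equiv.Perm E} {w : E → ℤ × ℤ}
    (h : ∀ e, OrderedAround rot w e) (hrot : ∀ e, rot e ≠ e) {u : ℤ × ℤ} (hu : u ≠ 0)
    (v : Quotient (Equiv.Perm.SameCycle.setoid rot)) :
    ∃! e, relAngle u (w (rot e)) < relAngle u (w e) ∧ Quotient.mk _ e = v := by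
  classical
  have hne : (Finset.univ.filter fun e => Quotient.mk (Equiv.Perm.SameCycle.setoid rot) e = v).Nonempty :=
    ⟨v.out, by simp⟩
  obtain ⟨x, hx, hmin⟩ := Finset.exists_min_image _ (fun e => relAngle u (w e)) hne
  simp only [Finset.mem_filter, Finset.mem_univ, true_and] at hx hmin
  have hmk : ∀ i : ℕ, Quotient.mk (Equiv.Perm.SameCycle.setoid rot) ((rot ^ i) x) = v := fun i => by
    rw [← hx]
    exact Quotient.sound (⟨-i, by simp⟩ : rot.SameCycle _ _)
  have h0 := fun e => (h e).1
  have hlt0 : ∀ i, 0 < i → i < Function.minimalPeriod rot x →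
      relAngle u (w x) < relAngle u (w ((rot ^ i) x)) := fun i h1 h2 =>
    lt_of_le_of_ne (hmin _ (hmk i)) fun heq =>
      (h x).2.1 i h1 h2 (sameRay_of_relAngle_eq hu (h0 _) (h0 _) heq).2.2
  have hlt : ∀ i j, i < j → j < Function.minimalPeriod rot x →
      relAngle u (w ((rot ^ i) x)) < relAngle u (w ((rot ^ j) x)) := fun i j hij hj => by
    rcases Nat.eq_zero_or_pos i with rfl | hi
    · simpa using hlt0 j hij hj
    · exact CcwOrdered.relAngle_lt hu (h0 _) (h0 _) (h0 _) ((h x).2.2 i j hi hij hj)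
        (hmin _ (hmk i)) (hmin _ (hmk j))
  have hp := rot.one_lt_minimalPeriod (hrot x)
  have hlast : rot ((rot ^ (Function.minimalPeriod rot x - 1)) x) = x := by
    rw [← Equiv.Perm.mul_apply, ← pow_succ', Nat.sub_add_cancel hp.le, Equiv.Perm.coe_pow]
    exact Function.iterate_minimalPeriod
  -- From the least angle, at `x`, the angles increase through the whole period, so the only descent
  -- is the last step, back to `x`.
  refine ⟨(rot ^ (Function.minimalPeriod rot x - 1)) x, ⟨?_, hmk _⟩, ?_⟩
  · rw [hlast]
    exact hlt0 _ (by omega) (by omega)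
  · rintro e ⟨he, hev⟩
    obtain ⟨i, hi, rfl⟩ := rot.exists_pow_of_mk_eq x e (hev.trans hx.symm)
    by_contra hne
    have hi' : i + 1 < Function.minimalPeriod rot x := by
      rcases Nat.lt_or_ge (i + 1) (Function.minimalPeriod rot x) with h | h
      · exact h
      · exact (hne (by congr 2; omega)).elim
    have := hlt i (i + 1) (by omega) hi'
    rw [pow_succ', Equiv.Perm.mul_apply] at this
    linarith

/-! ### Matchings as cochains and their crossings with zigzag paths -/

theorem wedge_add_right (u v w : ℤ × ℤ) : wedge u (v + w) = wedge u v + wedge u w := by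
  simp only [wedge, Prod.fst_add, Prod.snd_add]; ring

theorem wedge_neg_right (u v : ℤ × ℤ) : wedge u (-v) = -wedge u v := by
  simp only [wedge, Prod.fst_neg, Prod.snd_neg]; ring

open Classical in
/-- Summation by parts on the orbits of a permutation. -/
theorem Equiv.Perm.sum_mul_eq_zero {E : Type*} [Fintype E] (σ : Equiv.Perm E) {d k : E → ℚ}
    (hk : ∀ e, k (σ e) = k e)
    (hd : ∀ v, ∑ e ∈ Finset.univ.filter
      (fun e => Quotient.mk (Equiv.Perm.SameCycle.setoid σ) e = v), d e = 0) :
    ∑ e, d e * k e = 0 := by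
  have : Fintype (Quotient (Equiv.Perm.SameCycle.setoid σ)) := Fintype.ofFinite _
  rw [← Finset.sum_fiberwise (s := Finset.univ)
    (g := fun e : E => Quotient.mk (Equiv.Perm.SameCycle.setoid σ) e) (f := fun e => d e * k e)]
  refine Finset.sum_eq_zero fun v _ => ?_
  have h : ∀ e ∈ Finset.univ.filter
      (fun e => Quotient.mk (Equiv.Perm.SameCycle.setoid σ) e = v), d e * k e = d e * k v.out := by
    intro e he
    simp only [Finset.mem_filter, Finset.mem_univ, true_and] at he
    rw [σ.lift_of_invariant k hk (Quotient.exact (he.trans (Quotient.out_eq v).symm))]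
  rw [Finset.sum_congr rfl h, ← Finset.sum_mul, hd, zero_mul]

namespace TorusDimer

open BipartiteMap

variable {E : Type*} [Fintype E] (D : TorusDimer E)

open Classical in
/-- The indicator functions of perfect matchings. -/
structure IsMatching (m : E → ℤ) : Prop where
  nonneg : ∀ e, 0 ≤ m e
  white_sum : ∀ v, ∑ e ∈ Finset.univ.filter (fun e => D.whiteEnd e = v), m e = 1
  black_sum : ∀ v, ∑ e ∈ Finset.univ.filter (fun e => D.blackEnd e = v), m e = 1

open Classical in
/-- The cochains whose sum at each node vanishes. -/
structure IsCycle (d : E → ℤ) : Prop where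
  white_sum : ∀ v, ∑ e ∈ Finset.univ.filter (fun e => D.whiteEnd e = v), d e = 0
  black_sum : ∀ v, ∑ e ∈ Finset.univ.filter (fun e => D.blackEnd e = v), d e = 0

/-- The sum of the weights with multiplicities. -/
def position (m : E → ℤ) : ℤ × ℤ := ∑ e, m e • D.weight e

open Classical in
/-- The effect on a perfect matching of flipping a zigzag path from the edges that it runs through
towards white to those that it runs through towards black. -/
def flipChain (Z : D.Zigzag) (e : E) : ℤ :=
  (if D.zigzagToBlack e = Z then 1 else 0) - if D.zigzagToWhite e = Z then 1 else 0

/-- The number of edges of a matching on a zigzag path. -/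
def crossing (m : E → ℤ) (Z : D.Zigzag) : ℤ := ∑ e, D.zigzagCochain Z e * m e

open Classical in
/-- Half of the length of a zigzag path. -/
def halfLength (Z : D.Zigzag) : ℕ := (Finset.univ.filter fun e => D.zigzagToWhite e = Z).card

variable {D}

theorem IsMatching.sub {m m' : E → ℤ} (h : D.IsMatching m) (h' : D.IsMatching m') :
    D.IsCycle (m - m') :=
  ⟨fun v => by simp [h.white_sum, h'.white_sum], fun v => by simp [h.black_sum, h'.black_sum]⟩

theorem IsMatching.add {m d : E → ℤ} (h : D.IsMatching m) (hd : D.IsCycle d)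
    (h0 : ∀ e, 0 ≤ m e + d e) : D.IsMatching (m + d) :=
  ⟨h0, fun v => by simp [Finset.sum_add_distrib, h.white_sum, hd.white_sum],
    fun v => by simp [Finset.sum_add_distrib, h.black_sum, hd.black_sum]⟩

theorem IsCycle.neg {d : E → ℤ} (h : D.IsCycle d) : D.IsCycle (-d) :=
  ⟨fun v => by simp [h.white_sum], fun v => by simp [h.black_sum]⟩

theorem IsCycle.sum {ι : Type*} {s : Finset ι} {d : ι → E → ℤ} (h : ∀ i ∈ s, D.IsCycle (d i)) :
    D.IsCycle (∑ i ∈ s, d i) := by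
  classical
  constructor <;> intro v <;> simp only [Finset.sum_apply] <;> rw [Finset.sum_comm] <;>
    refine Finset.sum_eq_zero fun i hi => ?_
  · exact (h i hi).white_sum v
  · exact (h i hi).black_sum v

theorem position_add (m d : E → ℤ) : D.position (m + d) = D.position m + D.position d := by
  simp only [position, Pi.add_apply, add_smul, Finset.sum_add_distrib]

theorem position_neg (d : E → ℤ) : D.position (-d) = -D.position d := by
  simp only [position, Pi.neg_apply, neg_smul, Finset.sum_neg_distrib]

theorem position_sub (m d : E → ℤ) : D.position (m - d) = D.position m - D.position d := by
  rw [sub_eq_add_neg, position_add, position_neg, ← sub_eq_add_neg]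

theorem position_sum {ι : Type*} (s : Finset ι) (d : ι → E → ℤ) :
    D.position (∑ i ∈ s, d i) = ∑ i ∈ s, D.position (d i) := by
  simp only [position, Finset.sum_apply, Finset.sum_smul]
  rw [Finset.sum_comm]

/-- A difference of functions that are carried to each other around the nodes is a cycle. -/
theorem isCycle_of_comp {a b : E → ℤ} (hw : ∀ e, a (D.white e) = b e)
    (hb : ∀ e, a (D.black e) = b e) : D.IsCycle (a - b) := by
  classical
  constructor <;> intro v
  · have := Equiv.sum_comp D.white fun e => if D.whiteEnd e = v then a e else 0
    simp only [whiteEnd_white, hw] at this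
    simp only [Pi.sub_apply, Finset.sum_sub_distrib, Finset.sum_filter, this, sub_self]
  · have := Equiv.sum_comp D.black fun e => if D.blackEnd e = v then a e else 0
    simp only [blackEnd_black, hb] at this
    simp only [Pi.sub_apply, Finset.sum_sub_distrib, Finset.sum_filter, this, sub_self]

theorem isCycle_flipChain (Z : D.Zigzag) : D.IsCycle (D.flipChain Z) := by
  classical
  exact isCycle_of_comp (a := fun e => if D.zigzagToBlack e = Z then 1 else 0)
    (b := fun e => if D.zigzagToWhite e = Z then 1 else 0) (fun e => by simp)
    (fun e => by simp)

theorem position_flipChain (Z : D.Zigzag) : D.position (D.flipChain Z) = D.winding Z := by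
  classical
  have h := Equiv.sum_comp D.white fun e => if D.zigzagToBlack e = Z then D.weight e else 0
  simp only [zigzagToBlack_white] at h
  simp only [position, flipChain, sub_smul, ite_smul, one_smul, zero_smul, Finset.sum_sub_distrib]
  rw [← h, winding, Finset.sum_sub_distrib, Finset.sum_filter, Finset.sum_filter]

/-- The position of a cycle determines how often it crosses a zigzag path. -/
theorem IsCycle.sum_zigzagCochain {d : E → ℤ} (hd : D.IsCycle d) (Z : D.Zigzag) :
    ∑ e, D.zigzagCochain Z e * d e = -wedge (D.winding Z) (D.position d) := by
  classical
  obtain ⟨g, k, hg, hk, hφ⟩ := D.exists_zigzag_potential Z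
  have h1 := D.white.sum_mul_eq_zero (d := fun e => (d e : ℚ)) hg
    (fun v => by exact_mod_cast hd.white_sum v)
  have h2 := D.black.sum_mul_eq_zero (d := fun e => (d e : ℚ)) hk
    (fun v => by exact_mod_cast hd.black_sum v)
  have h3 : wedge (D.winding Z) (D.position d) = ∑ e, d e * wedge (D.winding Z) (D.weight e) := by
    rw [position, wedge_sum]
    refine Finset.sum_congr rfl fun e _ => ?_
    simp only [wedge, Prod.smul_fst, Prod.smul_snd, smul_eq_mul]; ring
  rw [← @Int.cast_inj ℚ, h3]
  push_cast
  -- The inserted zeros are the pairings of the cycle with the two potentials; they turn the wedge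
  -- into the zigzag cochain.
  rw [← sub_zero (-∑ e, _), ← h1, ← add_zero (-∑ e, _), ← h2, ← Finset.sum_neg_distrib,
    ← Finset.sum_add_distrib, ← Finset.sum_sub_distrib]
  refine Finset.sum_congr rfl fun e _ => ?_
  rw [hφ]; ring

/-- The number of edges on `Z` is an affine function of the position. Combined with
`IsMatching.crossing_le`, every zigzag path yields a half-plane that contains the positions of all
matchings. -/
theorem IsMatching.crossing_sub {m m' : E → ℤ} (h : D.IsMatching m) (h' : D.IsMatching m')
    (Z : D.Zigzag) : D.crossing m Z - D.crossing m' Z =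
      -wedge (D.winding Z) (D.position m - D.position m') := by
  rw [← position_sub, ← (h.sub h').sum_zigzagCochain, crossing, crossing, ← Finset.sum_sub_distrib]
  exact Finset.sum_congr rfl fun e _ => by rw [Pi.sub_apply]; ring

open Classical in
theorem crossing_eq_white (m : E → ℤ) (Z : D.Zigzag) : D.crossing m Z =
    ∑ e ∈ Finset.univ.filter (fun e => D.zigzagToWhite e = Z), (m e + m (D.white e)) := by
  have h := Equiv.sum_comp D.white fun e => if D.zigzagToBlack e = Z then m e else 0
  simp only [zigzagToBlack_white] at h
  simp only [crossing, zigzagCochain, add_mul, ite_mul, one_mul, zero_mul, Finset.sum_add_distrib]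
  rw [← h, Finset.sum_filter, Finset.sum_filter]

open Classical in
theorem crossing_eq_black (m : E → ℤ) (Z : D.Zigzag) : D.crossing m Z =
    ∑ e ∈ Finset.univ.filter (fun e => D.zigzagToWhite e = Z),
      (m (D.white e) + m (D.zigzagPerm e)) := by
  have h := Equiv.sum_comp D.zigzagPerm fun e => if D.zigzagToWhite e = Z then m e else 0
  simp only [zigzagToWhite_zigzagPerm] at h
  rw [crossing_eq_white, Finset.sum_add_distrib, Finset.sum_add_distrib, Finset.sum_filter,
    Finset.sum_filter, Finset.sum_filter, h]
  ring

variable (hD : D.ProperlyOrdered)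

include hD

theorem IsMatching.add_white_le {m : E → ℤ} (h : D.IsMatching m) (e : E) :
    m e + m (D.white e) ≤ 1 := by
  classical
  rw [← h.white_sum (D.whiteEnd e), ← Finset.sum_pair (hD.not_fixed e).1.symm]
  refine Finset.sum_le_sum_of_subset_of_nonneg ?_ fun _ _ _ => h.nonneg _
  intro x hx
  rcases Finset.mem_insert.1 hx with rfl | hx
  · simp
  · rw [Finset.mem_singleton.1 hx]; simp

theorem IsMatching.add_black_le {m : E → ℤ} (h : D.IsMatching m) (e : E) :
    m (D.black e) + m e ≤ 1 := by
  classical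
  rw [← h.black_sum (D.blackEnd e), ← Finset.sum_pair (hD.not_fixed e).2]
  refine Finset.sum_le_sum_of_subset_of_nonneg ?_ fun _ _ _ => h.nonneg _
  intro x hx
  rcases Finset.mem_insert.1 hx with rfl | hx
  · simp
  · rw [Finset.mem_singleton.1 hx]; simp

omit hD in
theorem black_zigzagPerm (e : E) : D.black (D.zigzagPerm e) = D.white e := by simp [zigzagPerm]

theorem IsMatching.crossing_le {m : E → ℤ} (h : D.IsMatching m) (Z : D.Zigzag) :
    D.crossing m Z ≤ D.halfLength Z := by
  classical
  rw [crossing_eq_white, halfLength]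
  simpa using Finset.sum_le_card_nsmul (Finset.univ.filter fun e => D.zigzagToWhite e = Z) _ 1
    fun e _ => h.add_white_le hD e

/-- A matching that contains half of a zigzag path contains one of each two consecutive edges. -/
theorem IsMatching.eq_one_of_crossing {m : E → ℤ} (h : D.IsMatching m) {Z : D.Zigzag}
    (hZ : D.halfLength Z ≤ D.crossing m Z) {e : E} (he : D.zigzagToWhite e = Z) :
    m e + m (D.white e) = 1 ∧ m (D.white e) + m (D.zigzagPerm e) = 1 := by
  classical
  have key : ∀ f : E → ℤ, (∀ e, f e ≤ 1) →
      D.crossing m Z = ∑ e ∈ Finset.univ.filter (fun e => D.zigzagToWhite e = Z), f e →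
      f e = 1 := by
    intro f hf hs
    have h1 : ∑ e ∈ Finset.univ.filter (fun e => D.zigzagToWhite e = Z), (1 - f e) ≤ 0 := by
      rw [Finset.sum_sub_distrib, ← hs]
      simp only [Finset.sum_const, nsmul_eq_mul, mul_one]
      rw [halfLength] at hZ
      linarith
    have h2 := (Finset.sum_eq_zero_iff_of_nonneg (fun e _ => sub_nonneg.2 (hf e))).1
      (le_antisymm h1 (Finset.sum_nonneg fun e _ => sub_nonneg.2 (hf e))) e (by simp [he])
    linarith
  refine ⟨key (fun e => m e + m (D.white e)) (h.add_white_le hD) (crossing_eq_white m Z),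
    key (fun e => m (D.white e) + m (D.zigzagPerm e)) (fun e => ?_) (crossing_eq_black m Z)⟩
  have := h.add_black_le hD (D.zigzagPerm e)
  rwa [black_zigzagPerm] at this

/-- A matching that contains half of a zigzag path contains every other edge. -/
theorem IsMatching.eq_of_crossing {m : E → ℤ} (h : D.IsMatching m) {Z : D.Zigzag}
    (hZ : D.halfLength Z ≤ D.crossing m Z) {e e' : E} (he : D.zigzagToWhite e = Z)
    (he' : D.zigzagToWhite e' = Z) : m e = m e' := by
  classical
  have hs : D.zigzagPerm.SameCycle e e' := Quotient.exact (he.trans he'.symm)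
  have := D.zigzagPerm.lift_of_invariant
    (fun e => if D.zigzagToWhite e = Z then m e else 0) (fun e => ?_) hs
  · simpa [he, he'] using this
  · simp only [zigzagToWhite_zigzagPerm]
    by_cases h1 : D.zigzagToWhite e = Z
    · simp only [h1, if_true]
      have := h.eq_one_of_crossing hD hZ h1
      linarith
    · simp [h1]

omit hD in
theorem IsMatching.le_crossing_of_toWhite {m : E → ℤ} (h : D.IsMatching m) {Z : D.Zigzag}
    (hZ : ∀ e, D.zigzagToWhite e = Z → m e = 1) : D.halfLength Z ≤ D.crossing m Z := by
  classical
  rw [crossing_eq_white, halfLength, Finset.cast_card]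
  refine Finset.sum_le_sum fun e he => ?_
  simp only [Finset.mem_filter, Finset.mem_univ, true_and] at he
  rw [hZ e he]
  linarith [h.nonneg (D.white e)]

omit hD in
theorem IsMatching.le_crossing_of_toBlack {m : E → ℤ} (h : D.IsMatching m) {Z : D.Zigzag}
    (hZ : ∀ e, D.zigzagToBlack e = Z → m e = 1) : D.halfLength Z ≤ D.crossing m Z := by
  classical
  rw [crossing_eq_white, halfLength, Finset.cast_card]
  refine Finset.sum_le_sum fun e he => ?_
  simp only [Finset.mem_filter, Finset.mem_univ, true_and] at he
  rw [hZ (D.white e) (by simpa using he)]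
  linarith [h.nonneg e]

/-- A matching that contains half of a zigzag path is extremal in the direction of its winding. -/
theorem IsMatching.wedge_nonneg {m m' : E → ℤ} (h : D.IsMatching m) (h' : D.IsMatching m')
    {Z : D.Zigzag} (hZ : D.halfLength Z ≤ D.crossing m Z) :
    0 ≤ wedge (D.winding Z) (D.position m' - D.position m) := by
  have h1 := h'.crossing_sub h Z
  have h2 := h'.crossing_le hD Z
  linarith

-- Containing half of a path depends only on the position: a displacement parallel to the winding
-- does not change the number of edges on the path.
omit hD in
theorem IsMatching.le_crossing_of_wedge {m m' : E → ℤ} (h : D.IsMatching m)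
    (h' : D.IsMatching m') {Z : D.Zigzag} (hZ : D.halfLength Z ≤ D.crossing m Z)
    (hw : wedge (D.winding Z) (D.position m' - D.position m) = 0) :
    D.halfLength Z ≤ D.crossing m' Z := by
  have h1 := h'.crossing_sub h Z
  linarith

end TorusDimer

/-! ### Matchings from cuts of the circle of directions -/

/-- A vector `q` parallel to `u` cannot point backwards because of `a`, nor forwards because of `b`.
-/
theorem eq_zero_of_wedge {u a b q : ℤ × ℤ} (hu : u ≠ 0) (ha : 0 < wedge a u) (hb : 0 < wedge u b)
    (h : wedge u q = 0) (haq : 0 ≤ wedge a q) (hbq : 0 ≤ wedge b q) : q = 0 := by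
  obtain ⟨u1, u2⟩ := u
  obtain ⟨a1, a2⟩ := a
  obtain ⟨b1, b2⟩ := b
  obtain ⟨q1, q2⟩ := q
  simp only [wedge] at *
  have h1 : (u1 * u1 + u2 * u2) * (a1 * q2 - a2 * q1) =
      (u1 * q1 + u2 * q2) * (a1 * u2 - a2 * u1) := by
    linear_combination (a1 * u1 + a2 * u2) * h
  have h2 : (u1 * u1 + u2 * u2) * (b1 * q2 - b2 * q1) =
      -((u1 * q1 + u2 * q2) * (u1 * b2 - u2 * b1)) := by
    linear_combination (b1 * u1 + b2 * u2) * h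
  have hN : 0 ≤ u1 * u1 + u2 * u2 := add_nonneg (mul_self_nonneg _) (mul_self_nonneg _)
  have h3 : 0 ≤ u1 * q1 + u2 * q2 :=
    nonneg_of_mul_nonneg_left (h1 ▸ mul_nonneg hN haq) ha
  have h4 : u1 * q1 + u2 * q2 ≤ 0 := by
    by_contra! h5
    have := mul_pos h5 hb
    have := mul_nonneg hN hbq
    linarith
  have h5 : u1 * q1 + u2 * q2 = 0 := le_antisymm h4 h3
  have hN' : u1 * u1 + u2 * u2 ≠ 0 := by
    intro h6
    apply hu
    ext <;> simp only [Prod.fst_zero, Prod.snd_zero] <;>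
      nlinarith [mul_self_nonneg u1, mul_self_nonneg u2]
  have e1 : (u1 * u1 + u2 * u2) * q1 = 0 := by linear_combination u1 * h5 - u2 * h
  have e2 : (u1 * u1 + u2 * u2) * q2 = 0 := by linear_combination u2 * h5 + u1 * h
  rw [mul_eq_zero, or_iff_right hN'] at e1 e2
  rw [e1, e2]; rfl

/-- The vector `u` is a positive combination of `a` and `b`, with coefficients proportional to
`wedge u b` and `wedge a u`. -/
theorem wedge_nonneg_of_between {u a b q : ℤ × ℤ} (hab : 0 < wedge a b) (ha : 0 < wedge a u)
    (hb : 0 < wedge u b) (haq : 0 ≤ wedge a q) (hbq : 0 ≤ wedge b q) : 0 ≤ wedge u q := by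
  have h : wedge u q * wedge a b = wedge u b * wedge a q + wedge a u * wedge b q := by
    simp only [wedge]; ring
  exact nonneg_of_mul_nonneg_left
    (h ▸ add_nonneg (mul_nonneg hb.le haq) (mul_nonneg ha.le hbq)) hab

namespace TorusDimer

open BipartiteMap

variable {E : Type*} [Fintype E] (D : TorusDimer E)

/-- The angle of a zigzag path. -/
def angle (u : ℤ × ℤ) (Z : D.Zigzag) : ℝ := relAngle u (D.winding Z)

open Classical in
/-- The perfect matching of the edges for which a direction just before the angle `t` lies between
the directions of the two zigzag paths of the edge. -/
def cut (u : ℤ × ℤ) (t : ℝ) (e : E) : ℤ :=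
  -- The total is 1 if the path towards white comes before the path towards black when angles are
  -- read cyclically from `t` on, `t` included, and 0 otherwise.
  (if D.angle u (D.zigzagToWhite e) < D.angle u (D.zigzagToBlack e) then 1 else 0) +
    ((if D.angle u (D.zigzagToBlack e) < t then 1 else 0) -
      if D.angle u (D.zigzagToWhite e) < t then 1 else 0)

variable {D} (hD : D.ProperlyOrdered) {u : ℤ × ℤ} (hu : u ≠ 0)

/-- This is the sum of the flips with coefficients `f`; moving the threshold of a cut adds such a
cycle. -/
theorem isCycle_threshold (f : D.Zigzag → ℤ) :
    D.IsCycle fun e => f (D.zigzagToBlack e) - f (D.zigzagToWhite e) :=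
  isCycle_of_comp (a := fun e => f (D.zigzagToBlack e)) (b := fun e => f (D.zigzagToWhite e))
    (fun e => by simp) (fun e => by simp)

include hD hu

theorem ProperlyOrdered.angle_ne (e : E) :
    D.angle u (D.zigzagToBlack e) ≠ D.angle u (D.zigzagToWhite e) := fun h =>
  hD.not_sameRay e (sameRay_of_relAngle_eq hu (hD.winding_ne_zero _) (hD.winding_ne_zero _) h).2.2

omit hD hu in
theorem cut_nonneg (t : ℝ) (e : E) : 0 ≤ D.cut u t e := by
  classical
  rw [cut]
  split_ifs <;> first | (norm_num; done) | (exfalso; linarith)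

/-- Without the threshold terms the chosen edges are the descents of the angle, one around each
node. The threshold terms form a cycle and keep the values nonnegative. -/
theorem ProperlyOrdered.isMatching_cut (t : ℝ) : D.IsMatching (D.cut u t) := by
  classical
  have h0 : D.IsMatching (fun e => if D.angle u (D.zigzagToWhite e) < D.angle u (D.zigzagToBlack e)
      then 1 else 0) := by
    refine ⟨fun e => by split_ifs <;> norm_num, fun v => ?_, fun v => ?_⟩
    · rw [Finset.sum_boole, Finset.filter_filter]
      obtain ⟨e, ⟨he, hev⟩, huniq⟩ :=
        existsUnique_descent hD.1 (fun e => (hD.not_fixed e).1) hu v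
      rw [Nat.cast_eq_one, Finset.card_eq_one]
      -- Around a white node, `zigzagToWhite` labels the gap after an edge, so the descent from `e`
      -- to `white e` belongs to the edge `white e`. Around a black node, `zigzagToBlack` labels the
      -- gap before an edge, and the descent belongs to `e` itself.
      refine ⟨D.white e, ?_⟩
      ext x
      simp only [Finset.mem_filter, Finset.mem_univ, true_and, Finset.mem_singleton]
      constructor
      · rintro ⟨hx, hlt⟩
        have hx' : D.white (D.white⁻¹ x) = x := by simp
        rw [← huniq (D.white⁻¹ x) ⟨?_, ?_⟩, hx']
        · rw [hx']; exact hlt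
        · have := D.whiteEnd_white (D.white⁻¹ x)
          rw [hx', hx] at this
          exact this.symm
      · rintro rfl
        refine ⟨(D.whiteEnd_white e).trans hev, ?_⟩
        rw [zigzagToBlack_white]; exact he
    · rw [Finset.sum_boole, Finset.filter_filter]
      obtain ⟨e, ⟨he, hev⟩, huniq⟩ :=
        existsUnique_descent hD.2 (fun e => (hD.not_fixed e).2) hu v
      rw [Nat.cast_eq_one, Finset.card_eq_one]
      refine ⟨e, ?_⟩
      ext x
      simp only [Finset.mem_filter, Finset.mem_univ, true_and, Finset.mem_singleton]
      constructor
      · rintro ⟨hx, hlt⟩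
        refine huniq x ⟨?_, hx⟩
        rw [zigzagToBlack_black]; exact hlt
      · rintro rfl
        refine ⟨hev, ?_⟩
        rw [zigzagToBlack_black] at he; exact he
  exact h0.add (isCycle_threshold fun Z => if D.angle u Z < t then 1 else 0) (cut_nonneg t)

theorem ProperlyOrdered.cut_eq_one_of_toWhite {t : ℝ} {e : E}
    (he : D.angle u (D.zigzagToWhite e) = t) : D.cut u t e = 1 := by
  classical
  have h := hD.angle_ne hu e
  rw [cut]
  rw [he] at *
  rcases h.lt_or_gt with h | h
  · simp [h, h.not_gt]
  · simp [h, h.not_gt]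

/-- The zigzag path whose winding precedes the vector `v`. -/
theorem ProperlyOrdered.exists_prev {v : ℤ × ℤ} (hv : v ≠ 0) :
    ∃ Y, 0 < wedge (D.winding Y) v ∧
      (∀ e, D.zigzagToBlack e = Y → D.cut u (relAngle u v) e = 1) ∧
      ((∃ X, D.angle u X < relAngle u v) → D.angle u Y < relAngle u v ∧
        ∀ X, D.angle u X < relAngle u v → D.angle u X ≤ D.angle u Y) := by
  classical
  obtain ⟨X, hX⟩ := hD.exists_wedge_pos (neg_ne_zero.2 hv)
  have hX' : 0 < wedge (D.winding X) v := by
    simp only [wedge, Prod.fst_neg, Prod.snd_neg] at hX ⊢; linarith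
  have hpos := fun Y => wedge_pos_iff hu (hD.winding_ne_zero Y) hv
  have hXm := relAngle_mem u (D.winding X)
  rw [hpos] at hX'
  have hvm := relAngle_mem u v
  set t := relAngle u v
  -- The cyclic predecessor is the largest angle below `t` or, if there is none, the largest angle
  -- of all, reached across the direction `u`.
  by_cases hne : ∃ X, D.angle u X < t
  · obtain ⟨X₀, hX₀⟩ := hne
    obtain ⟨Y, hY, hmax⟩ := Finset.exists_max_image (Finset.univ.filter fun X => D.angle u X < t)
      (D.angle u) ⟨X₀, by simpa using hX₀⟩
    simp only [Finset.mem_filter, Finset.mem_univ, true_and] at hY hmax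
    have hYm := relAngle_mem u (D.winding Y)
    refine ⟨Y, ?_, ?_, fun _ => ⟨hY, hmax⟩⟩
    · rw [hpos]
      rw [angle] at hY
      left
      rcases hX' with ⟨h1, h2⟩ | h1
      · have := hmax X (by rw [angle]; linarith)
        rw [angle, angle] at this
        constructor <;> linarith
      · constructor <;> linarith
    · intro e he
      have h1 := hD.angle_ne hu e
      rw [cut, he] at *
      rcases h1.lt_or_gt with h | h
      · have h2 : ¬ D.angle u (D.zigzagToWhite e) < t := fun h3 => (hmax _ h3).not_gt h
        simp [hY, h2, h.not_gt]
      · simp [h, hY, h.trans hY]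
  · obtain ⟨Y, -, hmax⟩ := Finset.exists_max_image Finset.univ (D.angle u) ⟨X, Finset.mem_univ X⟩
    push Not at hne
    have hYm := relAngle_mem u (D.winding Y)
    refine ⟨Y, ?_, ?_, fun ⟨X, h⟩ => ((hne X).not_gt h).elim⟩
    · rw [hpos]
      right
      have h3 := hne X
      have h4 := hmax X (Finset.mem_univ X)
      rw [angle] at h3
      rw [angle, angle] at h4
      rcases hX' with ⟨h1, h2⟩ | h1 <;> linarith
    · intro e he
      have h1 := (hD.angle_ne hu e).lt_or_gt.resolve_left fun h => by
        rw [he] at h; exact (hmax _ (Finset.mem_univ _)).not_gt h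
      simp [cut, h1, (hne _).not_gt]

/-- The perfect matching just after `u` is determined by its position. -/
theorem ProperlyOrdered.eq_cut {m : E → ℤ} (hm : D.IsMatching m)
    (hpos : D.position m = D.position (D.cut u (-Real.pi))) : m = D.cut u (-Real.pi) := by
  classical
  have hc := fun t => hD.isMatching_cut hu t
  set d := m - D.cut u (-Real.pi) with hd
  have hdc : D.IsCycle d := hm.sub (hc _)
  have hdp : D.position d = 0 := by rw [hd, position_sub, hpos, sub_self]
  have hneg : ∀ Z, ¬ D.angle u Z < -Real.pi := fun Z => (relAngle_mem u (D.winding Z)).1.not_gt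
  -- Induction over the zigzag paths in the order of increasing angle.
  have key : ∀ n, ∀ Z, (Finset.univ.filter fun X => D.angle u X < D.angle u Z).card = n →
      ∀ e, D.zigzagToWhite e = Z ∨ D.zigzagToBlack e = Z → d e = 0 := by
    intro n
    induction n using Nat.strong_induction_on with
    | _ n ih =>
    intro Z hZ
    have ih' : ∀ X, D.angle u X < D.angle u Z →
        ∀ e, D.zigzagToWhite e = X ∨ D.zigzagToBlack e = X → d e = 0 := by
      intro X hX
      refine ih _ ?_ X rfl
      rw [← hZ]
      refine Finset.card_lt_card (Finset.ssubset_iff_of_subset ?_ |>.2 ⟨X, by simpa, by simp⟩)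
      intro Y hY
      simp only [Finset.mem_filter, Finset.mem_univ, true_and] at hY ⊢
      exact hY.trans hX
    set t := D.angle u Z with ht
    -- The difference `d` vanishes on the paths before `t`; on all other edges the thresholds `t`
    -- and `-π` give the same cut, so the sum is `m` there.
    have hm' : D.IsMatching (D.cut u t + d) := by
      refine (hc t).add hdc fun e => ?_
      by_cases h1 : D.angle u (D.zigzagToWhite e) < t
      · rw [ih' _ h1 e (Or.inl rfl), add_zero]; exact (hc t).nonneg e
      by_cases h2 : D.angle u (D.zigzagToBlack e) < t
      · rw [ih' _ h2 e (Or.inr rfl), add_zero]; exact (hc t).nonneg e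
      have h3 : D.cut u t e + d e = m e := by
        simp [hd, cut, h1, h2, hneg]
      rw [h3]; exact hm.nonneg e
    have hp' : D.position (D.cut u t + d) = D.position (D.cut u t) := by
      rw [position_add, hdp, add_zero]
    have hcZ : ∀ e, D.zigzagToWhite e = Z → D.cut u t e = 1 := fun e he =>
      hD.cut_eq_one_of_toWhite hu (by rw [he])
    have hsat : D.halfLength Z ≤ D.crossing (D.cut u t + d) Z :=
      (hc t).le_crossing_of_wedge hm' ((hc t).le_crossing_of_toWhite hcZ)
        (by rw [hp', sub_self]; simp [wedge])
    have hW : ∀ e, D.zigzagToWhite e = Z → (D.cut u t + d) e = 1 := by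
      intro e he
      by_contra hne
      have h0 : ∀ e, D.zigzagToWhite e = Z → (D.cut u t + d) e = 0 := fun e' he' => by
        rw [hm'.eq_of_crossing hD hsat he' he]
        have h1 := hm'.add_white_le hD e
        have h2 := hm'.nonneg e
        have h3 := hm'.nonneg (D.white e)
        omega
      -- If the other half of `Z` were present, flipping `Z` backwards would move the position by
      -- minus its winding, beyond the supporting line of the preceding path `Y`.
      have hm'' : D.IsMatching (D.cut u t + d + -D.flipChain Z) := by
        refine hm'.add (isCycle_flipChain Z).neg fun x => ?_
        simp only [Pi.neg_apply, flipChain]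
        by_cases hx : D.zigzagToBlack x = Z
        · have h1 := (hm'.eq_one_of_crossing hD hsat (e := D.white⁻¹ x) hx).1
          have h2 : D.white (D.white⁻¹ x) = x := by simp
          rw [h0 _ hx, h2] at h1
          have h3 : D.zigzagToWhite x ≠ Z := fun h => hD.zigzag_ne x (hx.trans h.symm)
          simp only [hx, h3, if_true, if_false]
          omega
        · have := hm'.nonneg x
          simp only [hx, if_false]
          split_ifs <;> omega
      obtain ⟨Y, hY, hYc, -⟩ := hD.exists_prev hu (hD.winding_ne_zero Z)
      have h1 := (hc t).wedge_nonneg hD hm'' ((hc t).le_crossing_of_toBlack hYc)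
      rw [position_add, hp', position_neg, position_flipChain, add_sub_cancel_left,
        wedge_neg_right] at h1
      linarith
    rintro e (he | he)
    · have h1 := hW e he
      rw [Pi.add_apply, hcZ e he] at h1
      linarith
    · have h2 : D.white (D.white⁻¹ e) = e := by simp
      have h3 := hm'.add_white_le hD (D.white⁻¹ e)
      have h4 := (hc t).add_white_le hD (D.white⁻¹ e)
      have h5 := hm'.nonneg e
      have h6 := (hc t).nonneg e
      rw [h2, hW _ he] at h3
      rw [h2, hcZ _ he] at h4
      have h7 : (D.cut u t + d) e = D.cut u t e + d e := rfl
      linarith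
  have hd0 : d = 0 := funext fun e => key _ _ rfl e (Or.inl rfl)
  exact sub_eq_zero.1 hd0

end TorusDimer

/-! ### Matchings on a side of the polygon -/

namespace TorusDimer

open BipartiteMap

variable {E : Type*} [Fintype E] (D : TorusDimer E)

open Classical in
/-- The zigzag paths whose winding has the direction of `u`. -/
def sideZigzags (u : ℤ × ℤ) : Finset D.Zigzag := Finset.univ.filter fun Z => D.angle u Z = Real.pi

/-- The perfect matching just before the direction `u`, with the zigzag paths in `T` flipped. -/
def sideMatching (u : ℤ × ℤ) (T : Finset D.Zigzag) : E → ℤ :=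
  D.cut u Real.pi + ∑ Z ∈ T, D.flipChain Z

variable {D}

theorem mem_sideZigzags {u : ℤ × ℤ} {Z : D.Zigzag} :
    Z ∈ D.sideZigzags u ↔ D.angle u Z = Real.pi := by simp [sideZigzags]

open Classical in
theorem sum_flipChain_apply (T : Finset D.Zigzag) (e : E) : (∑ Z ∈ T, D.flipChain Z) e =
    (if D.zigzagToBlack e ∈ T then 1 else 0) - if D.zigzagToWhite e ∈ T then 1 else 0 := by
  simp [Finset.sum_apply, flipChain]

theorem lt_pi_iff {u : ℤ × ℤ} {Z : D.Zigzag} : D.angle u Z < Real.pi ↔ Z ∉ D.sideZigzags u := by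
  rw [mem_sideZigzags]
  exact (relAngle_mem u (D.winding Z)).2.lt_iff_ne

/-- Only the paths in the direction `u` fail to lie below the threshold `π`, and none lies below
`-π`. So flipping all of them leads from the cut just before `u` to the cut just after it. -/
theorem sideMatching_sideZigzags (u : ℤ × ℤ) :
    D.sideMatching u (D.sideZigzags u) = D.cut u (-Real.pi) := by
  classical
  funext e
  have h : ∀ Z, ¬ D.angle u Z < -Real.pi := fun Z => (relAngle_mem u (D.winding Z)).1.not_gt
  simp only [sideMatching, Pi.add_apply, sum_flipChain_apply, cut, lt_pi_iff, h]
  split_ifs <;> norm_num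

variable (hD : D.ProperlyOrdered) {u : ℤ × ℤ} (hu : IsCoprime u.1 u.2)

include hD hu

omit hD in
theorem ne_zero_of_isCoprime : u ≠ 0 := by
  rintro rfl
  exact not_isUnit_zero (isCoprime_self.1 (show IsCoprime (0 : ℤ) 0 from hu))

/-- Both `u` and the winding are primitive. Hence each flip moves the position by exactly one
segment. -/
theorem ProperlyOrdered.winding_eq {Z : D.Zigzag} (hZ : Z ∈ D.sideZigzags u) : D.winding Z = u := by
  obtain ⟨n, hn, h⟩ := exists_nsmul_of_relAngle_eq_pi hu (ne_zero_of_isCoprime hu)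
    (hD.winding_ne_zero Z) (mem_sideZigzags.1 hZ)
  obtain rfl : n = 1 := by
    by_contra h1
    exact hD.winding_ne_smul Z (by omega : 2 ≤ n) u h
  rw [h, one_smul]

theorem ProperlyOrdered.position_sideMatching {T : Finset D.Zigzag} (hT : T ⊆ D.sideZigzags u) :
    D.position (D.sideMatching u T) = D.position (D.cut u Real.pi) + T.card • u := by
  rw [sideMatching, position_add, position_sum]
  congr 1
  refine Finset.sum_eq_card_nsmul fun Z hZ => ?_
  rw [position_flipChain, hD.winding_eq hu (hT hZ)]

-- The two paths of an edge have different directions. Hence the paths of one side are edge-disjoint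
-- and can be flipped independently.
omit hD hu in
theorem ProperlyOrdered.not_mem_side (hD : D.ProperlyOrdered) {u : ℤ × ℤ} (hu : u ≠ 0) {e : E}
    (h : D.zigzagToWhite e ∈ D.sideZigzags u) : D.zigzagToBlack e ∉ D.sideZigzags u := fun h' =>
  hD.angle_ne hu e ((mem_sideZigzags.1 h').trans (mem_sideZigzags.1 h).symm)

theorem ProperlyOrdered.sideMatching_of_toWhite {T : Finset D.Zigzag} (hT : T ⊆ D.sideZigzags u)
    {e : E} (he : D.zigzagToWhite e ∈ D.sideZigzags u) [Decidable (D.zigzagToWhite e ∈ T)] :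
    D.sideMatching u T e = if D.zigzagToWhite e ∈ T then 0 else 1 := by
  classical
  have h1 := hD.cut_eq_one_of_toWhite (ne_zero_of_isCoprime hu) (mem_sideZigzags.1 he)
  have h2 := hD.not_mem_side (ne_zero_of_isCoprime hu) he
  have h3 : D.zigzagToBlack e ∉ T := fun h => h2 (hT h)
  simp only [sideMatching, Pi.add_apply, sum_flipChain_apply, h1, h3, if_false]
  split_ifs <;> norm_num

theorem ProperlyOrdered.sideMatching_of_toBlack {T : Finset D.Zigzag} (hT : T ⊆ D.sideZigzags u)
    {e : E} (he : D.zigzagToBlack e ∈ D.sideZigzags u) [Decidable (D.zigzagToBlack e ∈ T)] :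
    D.sideMatching u T e = if D.zigzagToBlack e ∈ T then 1 else 0 := by
  classical
  have h2 : D.zigzagToWhite e ∉ D.sideZigzags u := fun h =>
    hD.not_mem_side (ne_zero_of_isCoprime hu) h he
  have h3 : D.zigzagToWhite e ∉ T := fun h => h2 (hT h)
  have h4 : D.angle u (D.zigzagToWhite e) < D.angle u (D.zigzagToBlack e) := by
    rw [mem_sideZigzags.1 he, lt_pi_iff]; exact h2
  simp only [sideMatching, Pi.add_apply, sum_flipChain_apply, h3, if_false, cut, lt_pi_iff, he, h2,
    h4, if_true, not_true, not_false_eq_true]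
  split_ifs <;> norm_num

omit hD hu in
theorem sideMatching_of_not_mem {T : Finset D.Zigzag} (hT : T ⊆ D.sideZigzags u)
    {e : E} (hw : D.zigzagToWhite e ∉ D.sideZigzags u)
    (hb : D.zigzagToBlack e ∉ D.sideZigzags u) :
    D.sideMatching u T e = D.cut u Real.pi e := by
  classical
  have h3 : D.zigzagToWhite e ∉ T := fun h => hw (hT h)
  have h4 : D.zigzagToBlack e ∉ T := fun h => hb (hT h)
  simp only [sideMatching, Pi.add_apply, sum_flipChain_apply, h3, h4, if_false, sub_self, add_zero]

theorem ProperlyOrdered.isMatching_sideMatching {T : Finset D.Zigzag}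
    (hT : T ⊆ D.sideZigzags u) : D.IsMatching (D.sideMatching u T) := by
  classical
  refine (hD.isMatching_cut (ne_zero_of_isCoprime hu) Real.pi).add
    (IsCycle.sum fun Z _ => isCycle_flipChain Z) fun e => ?_
  change 0 ≤ D.sideMatching u T e
  by_cases hw : D.zigzagToWhite e ∈ D.sideZigzags u
  · rw [hD.sideMatching_of_toWhite hu hT hw]; split_ifs <;> norm_num
  by_cases hb : D.zigzagToBlack e ∈ D.sideZigzags u
  · rw [hD.sideMatching_of_toBlack hu hT hb]; split_ifs <;> norm_num
  rw [sideMatching_of_not_mem hT hw hb]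
  exact cut_nonneg _ _

theorem ProperlyOrdered.sideMatching_injOn :
    Set.InjOn (D.sideMatching u) {T | T ⊆ D.sideZigzags u} := by
  classical
  have key : ∀ T T', T ⊆ D.sideZigzags u → T' ⊆ D.sideZigzags u →
      D.sideMatching u T = D.sideMatching u T' → T ⊆ T' := by
    intro T T' hT hT' h Z hZ
    obtain ⟨e, rfl⟩ : ∃ e, D.zigzagToWhite e = Z := Quotient.exists_rep Z
    have h1 := congrFun h e
    rw [hD.sideMatching_of_toWhite hu hT (hT hZ), hD.sideMatching_of_toWhite hu hT' (hT hZ)] at h1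
    by_contra hZ'
    simp [hZ, hZ'] at h1
  exact fun T hT T' hT' h => (key T T' hT hT' h).antisymm (key T' T hT' hT h.symm)

/-- The zigzag paths whose windings precede and follow `u`. -/
theorem ProperlyOrdered.exists_prev_next : ∃ Y Z, 0 < wedge (D.winding Y) u ∧
    0 < wedge u (D.winding Z) ∧
    D.halfLength Y ≤ D.crossing (D.cut u Real.pi) Y ∧
    D.halfLength Z ≤ D.crossing (D.cut u (-Real.pi)) Z ∧
    (D.sideZigzags u = ∅ → 0 < wedge (D.winding Y) (D.winding Z)) := by
  classical
  have hu0 := ne_zero_of_isCoprime hu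
  have hπ := relAngle_self hu0
  obtain ⟨Y, hY, hYc, hYmax⟩ := hD.exists_prev hu0 hu0
  rw [hπ] at hYc hYmax
  obtain ⟨X, hX⟩ := hD.exists_wedge_pos hu0
  obtain ⟨Z, -, hmin⟩ := Finset.exists_min_image Finset.univ (D.angle u) ⟨X, Finset.mem_univ X⟩
  have hXm := relAngle_mem u (D.winding X)
  have hZm := relAngle_mem u (D.winding Z)
  rw [wedge_pos_iff hu0 hu0 (hD.winding_ne_zero X), hπ] at hX
  have hZX := hmin X (Finset.mem_univ X)
  rw [angle, angle] at hZX
  have hXneg : relAngle u (D.winding X) < 0 := by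
    rcases hX with ⟨h1, h2⟩ | h1 <;> linarith
  refine ⟨Y, Z, hY, ?_, ?_, ?_, ?_⟩
  · rw [wedge_pos_iff hu0 hu0 (hD.winding_ne_zero Z), hπ]
    right; linarith
  · exact (hD.isMatching_cut hu0 _).le_crossing_of_toBlack hYc
  · refine (hD.isMatching_cut hu0 _).le_crossing_of_toWhite fun e he => ?_
    have h : ∀ Z, ¬ D.angle u Z < -Real.pi := fun Z => (relAngle_mem u (D.winding Z)).1.not_gt
    have h1 := lt_of_le_of_ne (hmin (D.zigzagToBlack e) (Finset.mem_univ _))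
      (by rw [← he]; exact (hD.angle_ne hu0 e).symm)
    rw [← he] at h1
    simp [cut, h, h1]
  -- With no path in the direction `u`, `Y` has the largest and `Z` the smallest angle. Some winding
  -- lies to the left of that of `Y`, so the turn from `Y` across `u` to `Z` is less than `π`.
  · intro hS
    have hlt : ∀ X, D.angle u X < Real.pi := fun X => by rw [lt_pi_iff, hS]; simp
    obtain ⟨hY1, hY2⟩ := hYmax ⟨X, hlt X⟩
    obtain ⟨X', hX'⟩ := hD.exists_wedge_pos (hD.winding_ne_zero Y)
    rw [wedge_pos_iff hu0 (hD.winding_ne_zero Y) (hD.winding_ne_zero _)] at hX' ⊢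
    have h1 := hY2 X' (hlt X')
    have h2 := hmin X' (Finset.mem_univ _)
    rw [angle, angle] at h1 h2
    right
    rcases hX' with ⟨h3, h4⟩ | h3 <;> linarith

omit hD in
theorem ProperlyOrdered.side_le_crossing (hD : D.ProperlyOrdered) {Z : D.Zigzag}
    (hZ : Z ∈ D.sideZigzags u) :
    D.halfLength Z ≤ D.crossing (D.cut u Real.pi) Z := by
  have hu0 := ne_zero_of_isCoprime hu
  refine (hD.isMatching_cut hu0 _).le_crossing_of_toWhite fun e he => ?_
  exact hD.cut_eq_one_of_toWhite hu0 (by rw [he]; exact mem_sideZigzags.1 hZ)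

/-- The perfect matching just before `u` is extremal in the direction `u`. -/
theorem ProperlyOrdered.wedge_nonneg_of_isMatching {m : E → ℤ} (hm : D.IsMatching m) :
    0 ≤ wedge u (D.position m - D.position (D.cut u Real.pi)) := by
  have hu0 := ne_zero_of_isCoprime hu
  have hc := fun t => hD.isMatching_cut hu0 t
  -- If `u` is not a winding direction, the cuts before and after `u` coincide, and this matching is
  -- extremal for both neighbouring directions, hence for `u` between them.
  rcases (D.sideZigzags u).eq_empty_or_nonempty with hS | ⟨Z, hZ⟩
  · obtain ⟨Y, Z, hY, hZ, hYc, hZc, hYZ⟩ := hD.exists_prev_next hu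
    have h : D.cut u (-Real.pi) = D.cut u Real.pi := by
      rw [← sideMatching_sideZigzags, hS, sideMatching, Finset.sum_empty, add_zero]
    rw [h] at hZc
    exact wedge_nonneg_of_between (hYZ hS) hY hZ ((hc _).wedge_nonneg hD hm hYc)
      ((hc _).wedge_nonneg hD hm hZc)
  · have := (hc _).wedge_nonneg hD hm (hD.side_le_crossing hu hZ)
    rwa [hD.winding_eq hu hZ] at this

/-- The perfect matchings on the side of the polygon in the direction `u`. -/
theorem ProperlyOrdered.exists_sideMatching {m : E → ℤ} (hm : D.IsMatching m)
    (h0 : wedge u (D.position m - D.position (D.cut u Real.pi)) = 0) :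
    ∃ T ⊆ D.sideZigzags u, m = D.sideMatching u T := by
  classical
  have hu0 := ne_zero_of_isCoprime hu
  have hc := fun t => hD.isMatching_cut hu0 t
  have hsat : ∀ Z ∈ D.sideZigzags u, D.halfLength Z ≤ D.crossing m Z := fun Z hZ =>
    (hc _).le_crossing_of_wedge hm (hD.side_le_crossing hu hZ) (by rw [hD.winding_eq hu hZ, h0])
  -- These are the side paths of which `m` contains the half run through towards black, that is,
  -- those that appear flipped.
  set T := (D.sideZigzags u).filter fun Z => ∀ e, D.zigzagToWhite e = Z → m e = 0 with hTdef
  have hT : T ⊆ D.sideZigzags u := Finset.filter_subset _ _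
  have hmW : ∀ e, D.zigzagToWhite e ∈ D.sideZigzags u →
      m e = if D.zigzagToWhite e ∈ T then 0 else 1 := by
    intro e he
    split_ifs with h
    · exact (Finset.mem_filter.1 h).2 e rfl
    · have h1 : ∃ e', D.zigzagToWhite e' = D.zigzagToWhite e ∧ m e' ≠ 0 := by
        by_contra! h2
        exact h (Finset.mem_filter.2 ⟨he, h2⟩)
      obtain ⟨e', he', hne⟩ := h1
      rw [hm.eq_of_crossing hD (hsat _ he) he' rfl] at hne
      have h3 := hm.nonneg e
      have h4 := hm.nonneg (D.white e)
      have h5 := hm.add_white_le hD e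
      omega
  have hmB : ∀ e, D.zigzagToBlack e ∈ D.sideZigzags u →
      m e = if D.zigzagToBlack e ∈ T then 1 else 0 := by
    intro e he
    have h1 : D.white (D.white⁻¹ e) = e := by simp
    have h2 := (hm.eq_one_of_crossing hD (hsat _ he) (e := D.white⁻¹ e) rfl).1
    have h3 := hmW (D.white⁻¹ e) he
    have h4 : D.zigzagToWhite (D.white⁻¹ e) = D.zigzagToBlack e := rfl
    rw [h4] at h3
    rw [h1, h3] at h2
    split_ifs at h2 ⊢ <;> omega
  have hm1 : D.IsMatching (m + -∑ Z ∈ T, D.flipChain Z) := by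
    refine hm.add (IsCycle.sum fun Z _ => isCycle_flipChain Z).neg fun e => ?_
    rw [Pi.neg_apply, sum_flipChain_apply]
    have := hm.nonneg e
    by_cases hb : D.zigzagToBlack e ∈ T
    · have hw : D.zigzagToWhite e ∉ T := fun h => hD.not_mem_side hu0 (hT h) (hT hb)
      rw [hmB e (hT hb)]
      simp [hb, hw]
    · simp only [hb, if_false]
      split_ifs <;> omega
  have hm2 : D.IsMatching (m + -∑ Z ∈ T, D.flipChain Z + ∑ Z ∈ D.sideZigzags u, D.flipChain Z) := by
    refine hm1.add (IsCycle.sum fun Z _ => isCycle_flipChain Z) fun e => ?_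
    rw [sum_flipChain_apply]
    by_cases hw : D.zigzagToWhite e ∈ D.sideZigzags u
    · have hb := hD.not_mem_side hu0 hw
      have hb' : D.zigzagToBlack e ∉ T := fun h => hb (hT h)
      rw [Pi.add_apply, Pi.neg_apply, sum_flipChain_apply, hmW e hw]
      simp only [hw, hb, hb', if_true, if_false]
      split_ifs <;> norm_num
    · have := hm1.nonneg e
      simp only [hw, if_false]
      split_ifs <;> omega
  obtain ⟨Y, Z, hY, hZ, hYc, hZc, -⟩ := hD.exists_prev_next hu
  -- Undoing the flips in `T`, and then flipping the whole side, gives matchings displaced by the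
  -- same `q` from the two ends. The preceding path bounds `q` at one end, the following path at the
  -- other.
  set q := D.position (m + -∑ Z ∈ T, D.flipChain Z) - D.position (D.cut u Real.pi) with hq
  have hq2 : D.position (m + -∑ Z ∈ T, D.flipChain Z + ∑ Z ∈ D.sideZigzags u, D.flipChain Z) -
      D.position (D.cut u (-Real.pi)) = q := by
    rw [← sideMatching_sideZigzags, sideMatching, position_add, position_add (D.cut u Real.pi), hq]
    abel
  have huq : wedge u q = 0 := by
    have h1 : D.position (∑ Z ∈ T, D.flipChain Z) = T.card • u := by
      rw [position_sum]
      refine Finset.sum_eq_card_nsmul fun Z hZ => ?_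
      rw [position_flipChain, hD.winding_eq hu (hT hZ)]
    have h2 : q = (D.position m - D.position (D.cut u Real.pi)) + -(T.card • u) := by
      rw [hq, position_add, position_neg, h1]; abel
    rw [h2, wedge_add_right, h0, wedge_neg_right]
    simp only [wedge, Prod.smul_fst, Prod.smul_snd]
    simp only [nsmul_eq_mul]
    ring
  have hq0 : q = 0 := eq_zero_of_wedge hu0 hY hZ huq ((hc _).wedge_nonneg hD hm1 hYc)
    (hq2 ▸ (hc _).wedge_nonneg hD hm2 hZc)
  refine ⟨T, hT, ?_⟩
  -- Uniqueness is available for the cut just after `u`; cancelling the flips of the whole side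
  -- transfers it to the cut just before `u`.
  have h1 := hD.eq_cut hu0 hm2 (sub_eq_zero.1 (hq2.trans hq0))
  rw [← sideMatching_sideZigzags, sideMatching] at h1
  have h2 := add_right_cancel h1
  rw [sideMatching, ← h2]
  abel

end TorusDimer

/-! ### The Kasteleyn determinant and perfect matchings -/

namespace TorusDimer

open BipartiteMap

variable {E : Type*} [Fintype E] (D : TorusDimer E)

open Classical in
/-- The expansion of a coefficient of the determinant of the Kasteleyn matrix. -/
theorem coeff_kasteleynDet (c : E → ℂ) (h : Nonempty (D.WhiteNode ≃ D.BlackNode)) (A : ℤ × ℤ) :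
    (D.kasteleynDet c).coeff A = ∑ σ : Equiv.Perm D.WhiteNode, Equiv.Perm.sign σ •
      ∑ p ∈ Fintype.piFinset (fun v => Finset.univ.filter
        (fun e => D.whiteEnd e = σ v ∧ D.blackEnd e = h.some v)),
      if ∑ v, D.weight (p v) = A then ∏ v, c (p v) else 0 := by
  have hsmul : ∀ (z : ℤˣ) (x : AddMonoidAlgebra ℂ (ℤ × ℤ)), (z • x).coeff A = z • x.coeff A := by
    intro z x
    rcases Int.units_eq_one_or z with rfl | rfl <;> simp [Units.smul_def]
  rw [kasteleynDet, dif_pos h, Matrix.det_apply, AddMonoidAlgebra.coeff_sum, Finsupp.finsetSum_apply]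
  refine Finset.sum_congr rfl fun σ _ => ?_
  rw [hsmul]
  congr 1
  simp only [Matrix.submatrix_apply, kasteleyn, Matrix.of_apply, id]
  rw [Finset.prod_univ_sum, AddMonoidAlgebra.coeff_sum, Finsupp.finsetSum_apply]
  refine Finset.sum_congr rfl fun p _ => ?_
  rw [AddMonoidAlgebra.prod_single, AddMonoidAlgebra.coeff_single, Finsupp.single_apply]

variable {D}

open Classical in
/-- A choice of edges, one for each node of either colour, is a perfect matching. -/
theorem image_mem_matchingsAt {σ : Equiv.Perm D.WhiteNode} {h : D.WhiteNode ≃ D.BlackNode}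
    {p : D.WhiteNode → E} (hp : ∀ v, D.whiteEnd (p v) = σ v ∧ D.blackEnd (p v) = h v) :
    Finset.univ.image p ∈ D.matchingsAt (∑ v, D.weight (p v)) := by
  have hinj : Function.Injective p := fun v v' hv => h.injective (by
    rw [← (hp v).2, ← (hp v').2, hv])
  refine ⟨⟨fun v => ⟨p (σ.symm v), ⟨by simp, by simp [(hp _).1]⟩, ?_⟩,
    fun v => ⟨p (h.symm v), ⟨by simp, by simp [(hp _).2]⟩, ?_⟩⟩, ?_⟩
  · rintro e ⟨he, rfl⟩
    obtain ⟨v, -, rfl⟩ := Finset.mem_image.1 he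
    rw [(hp v).1, Equiv.symm_apply_apply]
  · rintro e ⟨he, rfl⟩
    obtain ⟨v, -, rfl⟩ := Finset.mem_image.1 he
    rw [(hp v).2, Equiv.symm_apply_apply]
  · rw [Finset.sum_image hinj.injOn]

theorem nonempty_matchingsAt_of_coeff {c : E → ℂ} {A : ℤ × ℤ}
    (hA : (D.kasteleynDet c).coeff A ≠ 0) : (D.matchingsAt A).Nonempty := by
  classical
  by_cases h : Nonempty (D.WhiteNode ≃ D.BlackNode)
  · rw [coeff_kasteleynDet D c h] at hA
    obtain ⟨σ, -, hσ⟩ := Finset.exists_ne_zero_of_sum_ne_zero hA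
    obtain ⟨p, hp, hpA⟩ := Finset.exists_ne_zero_of_sum_ne_zero (right_ne_zero_of_smul hσ)
    have hpA' : ∑ v, D.weight (p v) = A := by
      by_contra hne
      simp [hne] at hpA
    simp only [Fintype.mem_piFinset, Finset.mem_filter, Finset.mem_univ, true_and] at hp
    rw [← hpA']
    exact ⟨_, image_mem_matchingsAt hp⟩
  · rw [kasteleynDet, dif_neg h] at hA
    simp at hA

/-- Where there is only one perfect matching, there is no cancellation in the determinant. -/
theorem coeff_ne_zero_of_matchingsAt {c : E → ℂ} (hc : ∀ e, c e ≠ 0) {A : ℤ × ℤ} {M : Finset E}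
    (hA : D.matchingsAt A = {M}) : (D.kasteleynDet c).coeff A ≠ 0 := by
  classical
  have hM : M ∈ D.matchingsAt A := by rw [hA]; rfl
  obtain ⟨⟨hw, hb⟩, hMA⟩ := hM
  choose fw hfw hfw' using hw
  choose fb hfb hfb' using hb
  simp only [and_imp] at hfw' hfb'
  have hwb : ∀ v, fw (D.whiteEnd (fb v)) = fb v := fun v => (hfw' _ _ (hfb v).1 rfl).symm
  have hbw : ∀ v, fb (D.blackEnd (fw v)) = fw v := fun v => (hfb' _ _ (hfw v).1 rfl).symm
  -- The matching itself pairs the colours, so the determinant is not the default value 0. Only the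
  -- permutation that turns the arbitrary identification `h.some` into this pairing contributes at
  -- `A`.
  let φ : D.WhiteNode ≃ D.BlackNode := ⟨fun v => D.blackEnd (fw v), fun v => D.whiteEnd (fb v),
    fun v => by simp only [hbw, (hfw v).2], fun v => by simp only [hwb, (hfb v).2]⟩
  have h : Nonempty (D.WhiteNode ≃ D.BlackNode) := ⟨φ⟩
  rw [coeff_kasteleynDet D c h]
  have key : ∀ (σ : Equiv.Perm D.WhiteNode) (p : D.WhiteNode → E),
      (∀ v, D.whiteEnd (p v) = σ v ∧ D.blackEnd (p v) = h.some v) → ∑ v, D.weight (p v) = A →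
      σ = h.some.trans φ.symm ∧ p = fun v => fb (h.some v) := by
    intro σ p hp hpA
    have h1 := image_mem_matchingsAt hp
    rw [hpA, hA, Set.mem_singleton_iff] at h1
    have h2 : p = fun v => fb (h.some v) := by
      funext v
      refine hfb' _ _ ?_ (hp v).2
      rw [← h1]
      exact Finset.mem_image_of_mem _ (Finset.mem_univ v)
    refine ⟨?_, h2⟩
    ext v
    rw [← (hp v).1, h2]
    rfl
  rw [Finset.sum_eq_single (h.some.trans φ.symm)]
  · rw [Finset.sum_eq_single (fun v => fb (h.some v))]
    · have h1 : ∑ v, D.weight (fb (h.some v)) = A := by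
        rw [Equiv.sum_comp h.some (fun v => D.weight (fb v)), ← hMA]
        have h2 : M = Finset.univ.image fb := by
          ext e
          simp only [Finset.mem_image, Finset.mem_univ, true_and]
          exact ⟨fun he => ⟨D.blackEnd e, (hfb' _ _ he rfl).symm⟩, fun ⟨v, hv⟩ => hv ▸ (hfb v).1⟩
        rw [h2, Finset.sum_image]
        exact fun v _ v' _ hv => by rw [← (hfb v).2, ← (hfb v').2, hv]
      rw [if_pos h1]
      exact smul_ne_zero_iff_ne _ |>.2 (Finset.prod_ne_zero_iff.2 fun v _ => hc _)
    · intro p hp hne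
      rw [if_neg]
      intro hpA
      simp only [Fintype.mem_piFinset, Finset.mem_filter, Finset.mem_univ, true_and] at hp
      exact hne (key _ p hp hpA).2
    · intro hnot
      refine (hnot ?_).elim
      simp only [Fintype.mem_piFinset, Finset.mem_filter, Finset.mem_univ, true_and]
      exact fun v => ⟨rfl, (hfb _).2⟩
  · intro σ _ hσ
    rw [Finset.sum_eq_zero, smul_zero]
    intro p hp
    rw [if_neg]
    intro hpA
    simp only [Fintype.mem_piFinset, Finset.mem_filter, Finset.mem_univ, true_and] at hp
    exact hσ (key σ p hp hpA).1
  · exact fun hnot => (hnot (Finset.mem_univ _)).elim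

open Classical in
/-- The indicator function of a perfect matching. -/
theorem IsPerfectMatching.isMatching {M : Finset E} (hM : D.IsPerfectMatching M) :
    D.IsMatching (fun e => if e ∈ M then 1 else 0) := by
  have key : ∀ (p : E → Prop) [DecidablePred p], (∃! e, e ∈ M ∧ p e) →
      ∑ e ∈ Finset.univ.filter p, (if e ∈ M then (1 : ℤ) else 0) = 1 := by
    rintro p _ ⟨e, he, huniq⟩
    rw [Finset.sum_boole, Finset.filter_filter, Nat.cast_eq_one, Finset.card_eq_one]
    refine ⟨e, ?_⟩
    ext x
    simp only [Finset.mem_filter, Finset.mem_univ, true_and, Finset.mem_singleton]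
    exact ⟨fun h => huniq x ⟨h.2, h.1⟩, fun h => h ▸ ⟨he.2, he.1⟩⟩
  exact ⟨fun e => by split_ifs <;> norm_num, fun v => key _ (hM.1 v), fun v => key _ (hM.2 v)⟩

open Classical in
theorem position_indicator (M : Finset E) :
    D.position (fun e => if e ∈ M then 1 else 0) = ∑ e ∈ M, D.weight e := by
  simp [position]

open Classical in
theorem IsMatching.eq_one_or {m : E → ℤ} (hm : D.IsMatching m) (e : E) : m e = 0 ∨ m e = 1 := by
  have h1 : m e ≤ 1 := by
    rw [← hm.white_sum (D.whiteEnd e)]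
    exact Finset.single_le_sum (fun x _ => hm.nonneg x) (by simp)
  have h2 := hm.nonneg e
  omega

open Classical in
/-- The edges of a perfect matching that is given by its indicator function. -/
def edgesOf (m : E → ℤ) : Finset E := Finset.univ.filter fun e => m e = 1

theorem mem_edgesOf {m : E → ℤ} {e : E} : e ∈ edgesOf m ↔ m e = 1 := by simp [edgesOf]

open Classical in
theorem IsMatching.indicator_edgesOf {m : E → ℤ} (hm : D.IsMatching m) :
    (fun e => if e ∈ edgesOf m then 1 else 0) = m := by
  funext e
  simp only [mem_edgesOf]
  rcases hm.eq_one_or e with h | h <;> simp [h]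

open Classical in
theorem edgesOf_indicator (M : Finset E) : edgesOf (fun e => if e ∈ M then 1 else 0) = M := by
  ext e; simp [mem_edgesOf]

theorem IsMatching.edgesOf_mem_matchingsAt {m : E → ℤ} (hm : D.IsMatching m) :
    edgesOf m ∈ D.matchingsAt (D.position m) := by
  classical
  have key : ∀ (p : E → Prop) [DecidablePred p], ∑ e ∈ Finset.univ.filter p, m e = 1 →
      ∃! e, e ∈ edgesOf m ∧ p e := by
    intro p _ h
    rw [← hm.indicator_edgesOf, Finset.sum_boole, Finset.filter_filter, Nat.cast_eq_one,
      Finset.card_eq_one] at h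
    obtain ⟨e, he⟩ := h
    have h1 : ∀ x, (p x ∧ x ∈ edgesOf m) ↔ x = e := fun x => by
      have := Finset.ext_iff.1 he x
      simpa using this
    exact ⟨e, ((h1 e).2 rfl).symm, fun x hx => (h1 x).1 hx.symm⟩
  refine ⟨⟨fun v => key _ (hm.white_sum v), fun v => key _ (hm.black_sum v)⟩, ?_⟩
  rw [← position_indicator, hm.indicator_edgesOf]

end TorusDimer

/-! ### Flips along a side and the count of matchings -/

theorem nsmul_left_cancel {u : ℤ × ℤ} (hu : u ≠ 0) {a b : ℕ} (h : a • u = b • u) : a = b := by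
  by_contra hne
  have h1 : ((a : ℤ) - b) • u = 0 := by
    rw [sub_smul, natCast_zsmul, natCast_zsmul, h, sub_self]
  rcases smul_eq_zero.1 h1 with h2 | h2
  · omega
  · exact hu h2

namespace TorusDimer

open BipartiteMap

variable {E : Type*} [Fintype E] {D : TorusDimer E}

theorem mem_zigzagEdges {Z : D.Zigzag} {e : E} :
    e ∈ D.zigzagEdges Z ↔ D.zigzagToWhite e = Z ∨ D.zigzagToBlack e = Z := by
  simp [zigzagEdges]

theorem latticePoint_injective : Function.Injective latticePoint := by
  rintro ⟨a, b⟩ ⟨c, d⟩ h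
  simpa [latticePoint] using h

theorem mem_toricDiagram_of_matchingsAt {c : E → ℂ} (hc : ∀ e, c e ≠ 0) {A : ℤ × ℤ} {M : Finset E}
    (hA : D.matchingsAt A = {M}) : latticePoint A ∈ D.toricDiagram c :=
  subset_convexHull ℝ _
    ⟨A, by simpa using coeff_ne_zero_of_matchingsAt hc hA, rfl⟩

theorem nonempty_matchingsAt_of_extremePoint {c : E → ℂ} {A : ℤ × ℤ}
    (hA : latticePoint A ∈ (D.toricDiagram c).extremePoints ℝ) : (D.matchingsAt A).Nonempty := by
  obtain ⟨A', hA', h⟩ := extremePoints_convexHull_subset hA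
  rw [latticePoint_injective h] at hA'
  exact nonempty_matchingsAt_of_coeff (by simpa using hA')

theorem exists_isMatching_of_mem {A : ℤ × ℤ} {M : Finset E} (hM : M ∈ D.matchingsAt A) :
    ∃ m, D.IsMatching m ∧ D.position m = A ∧ edgesOf m = M := by
  classical
  exact ⟨_, hM.1.isMatching, (position_indicator M).trans hM.2, edgesOf_indicator M⟩

variable (hD : D.ProperlyOrdered) {u : ℤ × ℤ} (hu : IsCoprime u.1 u.2)

include hD

open Classical in
/-- A matching that contains one of the two halves of a zigzag path contains half of its edges. -/
theorem ProperlyOrdered.two_mul_card_inter {M : Finset E} {Z : D.Zigzag}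
    (h : (∀ e, D.zigzagToWhite e = Z → e ∈ M) ∧ (∀ e, D.zigzagToBlack e = Z → e ∉ M) ∨
      (∀ e, D.zigzagToWhite e = Z → e ∉ M) ∧ (∀ e, D.zigzagToBlack e = Z → e ∈ M)) :
    2 * (M ∩ D.zigzagEdges Z).card = (D.zigzagEdges Z).card := by
  set S := Finset.univ.filter fun e => D.zigzagToWhite e = Z with hS
  set S' := Finset.univ.filter fun e => D.zigzagToBlack e = Z with hS'
  have hunion : D.zigzagEdges Z = S ∪ S' := by
    ext e; simp [mem_zigzagEdges, hS, hS']
  have hdisj : Disjoint S S' := by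
    rw [Finset.disjoint_left]
    intro e he he'
    simp only [hS, hS', Finset.mem_filter, Finset.mem_univ, true_and] at he he'
    exact hD.zigzag_ne e (he'.trans he.symm)
  have himage : S' = S.image D.white := by
    ext e
    simp only [hS, hS', Finset.mem_filter, Finset.mem_univ, true_and, Finset.mem_image]
    constructor
    · exact fun h => ⟨D.white⁻¹ e, h, by simp⟩
    · rintro ⟨e, he, rfl⟩
      simpa using he
  have hcard : S'.card = S.card := by
    rw [himage, Finset.card_image_of_injective _ D.white.injective]
  have hinter : M ∩ D.zigzagEdges Z = S ∨ M ∩ D.zigzagEdges Z = S' := by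
    rcases h with ⟨h1, h2⟩ | ⟨h1, h2⟩
    · left
      ext e
      simp only [Finset.mem_inter, mem_zigzagEdges, hS, Finset.mem_filter, Finset.mem_univ, true_and]
      have := h1 e
      have := h2 e
      tauto
    · right
      ext e
      simp only [Finset.mem_inter, mem_zigzagEdges, hS', Finset.mem_filter, Finset.mem_univ, true_and]
      have := h1 e
      have := h2 e
      tauto
  rw [hunion, Finset.card_union_of_disjoint hdisj, ← hunion]
  rcases hinter with h | h <;> rw [h] <;> omega

include hu

theorem ProperlyOrdered.mem_edgesOf_of_toWhite {T : Finset D.Zigzag} (hT : T ⊆ D.sideZigzags u)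
    {e : E} (he : D.zigzagToWhite e ∈ D.sideZigzags u) :
    e ∈ edgesOf (D.sideMatching u T) ↔ D.zigzagToWhite e ∉ T := by
  classical
  rw [mem_edgesOf, hD.sideMatching_of_toWhite hu hT he]
  split_ifs with h <;> simp [h]

theorem ProperlyOrdered.mem_edgesOf_of_toBlack {T : Finset D.Zigzag} (hT : T ⊆ D.sideZigzags u)
    {e : E} (he : D.zigzagToBlack e ∈ D.sideZigzags u) :
    e ∈ edgesOf (D.sideMatching u T) ↔ D.zigzagToBlack e ∈ T := by
  classical
  rw [mem_edgesOf, hD.sideMatching_of_toBlack hu hT he]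
  split_ifs with h <;> simp [h]

open Classical in
/-- Two perfect matchings on the same side of the polygon arise from each other by flipping. -/
theorem ProperlyOrdered.arisesByFlipping {T T' : Finset D.Zigzag} (hT : T ⊆ D.sideZigzags u)
    (hT' : T' ⊆ D.sideZigzags u) :
    D.ArisesByFlipping (edgesOf (D.sideMatching u T)) (symmDiff T T').card
      (edgesOf (D.sideMatching u T')) := by
  have hu0 := ne_zero_of_isCoprime hu
  have hS : ∀ Z ∈ symmDiff T T', Z ∈ D.sideZigzags u := fun Z hZ => by
    rcases Finset.mem_symmDiff.1 hZ with h | h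
    · exact hT h.1
    · exact hT' h.1
  refine ⟨symmDiff T T', rfl, fun Z hZ => ?_, fun Z hZ Z' hZ' hne => ?_, ?_⟩
  · refine hD.two_mul_card_inter ?_
    have hW : ∀ e, D.zigzagToWhite e = Z → (e ∈ edgesOf (D.sideMatching u T) ↔ Z ∉ T) :=
      fun e he => by
        rw [hD.mem_edgesOf_of_toWhite hu hT (he ▸ hS Z hZ), he]
    have hB : ∀ e, D.zigzagToBlack e = Z → (e ∈ edgesOf (D.sideMatching u T) ↔ Z ∈ T) :=
      fun e he => by
        rw [hD.mem_edgesOf_of_toBlack hu hT (he ▸ hS Z hZ), he]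
    by_cases h : Z ∈ T
    · exact Or.inr ⟨fun e he => by simp [hW e he, h], fun e he => by simp [hB e he, h]⟩
    · exact Or.inl ⟨fun e he => by simp [hW e he, h], fun e he => by simp [hB e he, h]⟩
  · rw [Finset.disjoint_left]
    intro e he he'
    rw [mem_zigzagEdges] at he he'
    rcases he with he | he <;> rcases he' with he' | he'
    · exact hne (he.symm.trans he')
    · exact hD.not_mem_side hu0 (he ▸ hS Z hZ) (he' ▸ hS Z' hZ')
    · exact hD.not_mem_side hu0 (he' ▸ hS Z' hZ') (he ▸ hS Z hZ)
    · exact hne (he.symm.trans he')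
  · ext e
    have hU : e ∈ (symmDiff T T').biUnion D.zigzagEdges ↔
        D.zigzagToWhite e ∈ symmDiff T T' ∨ D.zigzagToBlack e ∈ symmDiff T T' := by
      simp only [Finset.mem_biUnion, mem_zigzagEdges]
      constructor
      · rintro ⟨Z, hZ, rfl | rfl⟩
        · exact Or.inl hZ
        · exact Or.inr hZ
      · rintro (h | h)
        · exact ⟨_, h, Or.inl rfl⟩
        · exact ⟨_, h, Or.inr rfl⟩
    simp only [Finset.mem_union, Finset.mem_sdiff, hU, Finset.mem_symmDiff]
    by_cases hw : D.zigzagToWhite e ∈ D.sideZigzags u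
    · have hb := hD.not_mem_side hu0 hw
      have h1 : D.zigzagToBlack e ∉ T := fun h => hb (hT h)
      have h2 : D.zigzagToBlack e ∉ T' := fun h => hb (hT' h)
      rw [hD.mem_edgesOf_of_toWhite hu hT hw, hD.mem_edgesOf_of_toWhite hu hT' hw]
      by_cases a : D.zigzagToWhite e ∈ T <;> by_cases b : D.zigzagToWhite e ∈ T' <;>
        simp [a, b, h1, h2]
    · have h1 : D.zigzagToWhite e ∉ T := fun h => hw (hT h)
      have h2 : D.zigzagToWhite e ∉ T' := fun h => hw (hT' h)
      by_cases hb : D.zigzagToBlack e ∈ D.sideZigzags u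
      · rw [hD.mem_edgesOf_of_toBlack hu hT hb, hD.mem_edgesOf_of_toBlack hu hT' hb]
        by_cases a : D.zigzagToBlack e ∈ T <;> by_cases b : D.zigzagToBlack e ∈ T' <;>
          simp [a, b, h1, h2]
      · have h3 : D.zigzagToBlack e ∉ T := fun h => hb (hT h)
        have h4 : D.zigzagToBlack e ∉ T' := fun h => hb (hT' h)
        rw [mem_edgesOf, mem_edgesOf, sideMatching_of_not_mem hT hw hb,
          sideMatching_of_not_mem hT' hw hb]
        simp [h1, h2, h3, h4]

/-- The perfect matchings at a lattice point on a side of the polygon. -/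
theorem ProperlyOrdered.matchingsAt_eq (j : ℕ) :
    D.matchingsAt (D.position (D.cut u Real.pi) + j • u) =
      (fun T => edgesOf (D.sideMatching u T)) ''
        ((D.sideZigzags u).powersetCard j : Set (Finset D.Zigzag)) := by
  have hu0 := ne_zero_of_isCoprime hu
  ext M
  simp only [Set.mem_image, Finset.mem_coe, Finset.mem_powersetCard]
  constructor
  · intro hM
    obtain ⟨m, hm, hmA, rfl⟩ := exists_isMatching_of_mem hM
    obtain ⟨T, hT, rfl⟩ := hD.exists_sideMatching hu hm (by
      rw [hmA, add_sub_cancel_left]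
      simp only [wedge, Prod.smul_fst, Prod.smul_snd]
      simp only [nsmul_eq_mul]
      ring)
    refine ⟨T, ⟨hT, ?_⟩, rfl⟩
    rw [hD.position_sideMatching hu hT] at hmA
    exact nsmul_left_cancel hu0 (add_left_cancel hmA)
  · rintro ⟨T, ⟨hT, rfl⟩, rfl⟩
    rw [← hD.position_sideMatching hu hT]
    exact (hD.isMatching_sideMatching hu hT).edgesOf_mem_matchingsAt

theorem ProperlyOrdered.ncard_matchingsAt (j : ℕ) :
    (D.matchingsAt (D.position (D.cut u Real.pi) + j • u)).ncard =
      (D.sideZigzags u).card.choose j := by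
  rw [hD.matchingsAt_eq hu, Set.InjOn.ncard_image, Set.ncard_coe_finset, Finset.card_powersetCard]
  intro T hT T' hT' h
  simp only [Finset.mem_coe, Finset.mem_powersetCard] at hT hT'
  refine hD.sideMatching_injOn hu hT.1 hT'.1 ?_
  rw [← (hD.isMatching_sideMatching hu hT.1).indicator_edgesOf,
    ← (hD.isMatching_sideMatching hu hT'.1).indicator_edgesOf]
  simp only at h
  rw [h]

/-- At an end of a side there is only one perfect matching. -/
theorem ProperlyOrdered.matchingsAt_end {T : Finset D.Zigzag} (hT : T = ∅ ∨ T = D.sideZigzags u) :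
    D.matchingsAt (D.position (D.cut u Real.pi) + T.card • u) =
      {edgesOf (D.sideMatching u T)} := by
  rw [hD.matchingsAt_eq hu]
  rcases hT with rfl | rfl <;> simp

/-- A matching at `B` flips some set of side paths. If the set is neither empty nor full, `B` lies
strictly between the two ends of the side. Both ends belong to the diagram, having a single matching
each, so `B` would not be extreme. -/
theorem ProperlyOrdered.exists_end {c : E → ℂ} (hc : ∀ e, c e ≠ 0) {B : ℤ × ℤ}
    (hB : latticePoint B ∈ (D.toricDiagram c).extremePoints ℝ)
    (hw : wedge u (B - D.position (D.cut u Real.pi)) = 0) :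
    ∃ T, (T = ∅ ∨ T = D.sideZigzags u) ∧ B = D.position (D.cut u Real.pi) + T.card • u := by
  have hu0 := ne_zero_of_isCoprime hu
  obtain ⟨M, hM⟩ := nonempty_matchingsAt_of_extremePoint hB
  obtain ⟨m, hm, rfl, -⟩ := exists_isMatching_of_mem hM
  obtain ⟨T, hT, rfl⟩ := hD.exists_sideMatching hu hm hw
  rw [hD.position_sideMatching hu hT] at hB ⊢
  refine ⟨T, ?_, rfl⟩
  have h0 := mem_toricDiagram_of_matchingsAt hc (hD.matchingsAt_end hu (T := ∅) (Or.inl rfl))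
  have h1 := mem_toricDiagram_of_matchingsAt hc
    (hD.matchingsAt_end hu (T := D.sideZigzags u) (Or.inr rfl))
  by_contra! hne
  have hpos : 0 < T.card := Finset.card_pos.2 hne.1
  have hlt : T.card < (D.sideZigzags u).card := Finset.card_lt_card (hT.ssubset_of_ne hne.2)
  have hn : (0 : ℝ) < (D.sideZigzags u).card := by exact_mod_cast hpos.trans hlt
  have hlt' : (T.card : ℝ) < (D.sideZigzags u).card := by exact_mod_cast hlt
  have hpos' : (0 : ℝ) < T.card := by exact_mod_cast hpos
  have h2 := ((mem_extremePoints.1 hB).2 _ h0 _ h1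
    ⟨1 - (T.card : ℝ) / (D.sideZigzags u).card, (T.card : ℝ) / (D.sideZigzags u).card,
      by rw [sub_pos, div_lt_one hn]; exact hlt', by positivity, by ring, ?_⟩).1
  · have h3 := add_left_cancel (latticePoint_injective h2)
    have h4 := nsmul_left_cancel hu0 h3
    rw [Finset.card_empty] at h4
    omega
  · ext <;> simp [latticePoint] <;> field_simp <;> ring

-- An end is comparable with every subset, so the symmetric difference is a plain difference.
omit hu hD in
open Classical in
theorem card_symmDiff_end {S T₀ T : Finset D.Zigzag} (h₀ : T₀ = ∅ ∨ T₀ = S) (hT : T ⊆ S) :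
    ((symmDiff T₀ T).card : ℤ) = |(T₀.card : ℤ) - T.card| := by
  have h := Finset.card_le_card hT
  rcases h₀ with rfl | rfl
  · simp [symmDiff]
  · rw [symmDiff_of_ge hT, Finset.card_sdiff_of_subset hT, Nat.cast_sub h, abs_of_nonneg]
    rw [sub_nonneg]
    exact_mod_cast h

end TorusDimer

open TorusDimer in
theorem mainTheorem9 {E : Type*} [Fintype E] (D : TorusDimer E) (hD : D.ProperlyOrdered)
    (c : E → ℂ) (hc : ∀ e, c e ≠ 0) (A B C : ℤ × ℤ) (p q : ℕ)
    (hA : BoundaryPosition (D.toricDiagram c) A B C p q) :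
    (∃ MB MC : Finset E, D.matchingsAt B = {MB} ∧ D.matchingsAt C = {MC} ∧
      ∀ M ∈ D.matchingsAt A, D.ArisesByFlipping MB p M ∧ D.ArisesByFlipping MC q M) ∧
    (D.matchingsAt A).ncard = (p + q).choose q := by
  classical
  obtain ⟨hB, hC, u, hu, hline, hBA, hCA⟩ := hA
  have hu0 := ne_zero_of_isCoprime hu
  set A₀ := D.position (D.cut u Real.pi) with hA₀
  have huu : ∀ n : ℕ, wedge u (n • u) = 0 := fun n => by
    simp only [wedge, Prod.smul_fst, Prod.smul_snd]
    simp only [nsmul_eq_mul]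
    ring
  -- The line through `A` supports the diagram, which contains `A₀`; the line through `A₀` supports
  -- all matchings, among them one at `B`. The two inequalities identify the lines.
  have h1 : wedge u (A₀ - A) ≥ 0 := by
    have h := hline _ (mem_toricDiagram_of_matchingsAt hc
      (hD.matchingsAt_end hu (T := ∅) (Or.inl rfl)))
    rw [Finset.card_empty, zero_smul, add_zero, ← hA₀] at h
    simp only [latticePoint] at h
    simp only [wedge, Prod.fst_sub, Prod.snd_sub]
    exact_mod_cast h
  have h2 : 0 ≤ wedge u (B - A₀) := by
    obtain ⟨M, hM⟩ := nonempty_matchingsAt_of_extremePoint hB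
    obtain ⟨m, hm, rfl, -⟩ := exists_isMatching_of_mem hM
    exact hD.wedge_nonneg_of_isMatching hu hm
  have h3 : wedge u (B - A₀) = -wedge u (A₀ - A) := by
    have : B - A₀ = p • u + -(A₀ - A) := by rw [hBA]; abel
    rw [this, wedge_add_right, huu, wedge_neg_right, zero_add]
  have h4 : wedge u (B - A₀) = 0 := by linarith
  have h5 : wedge u (C - A₀) = 0 := by
    have : C - A₀ = -(q • u) + -(A₀ - A) := by rw [hCA]; abel
    rw [this, wedge_add_right, wedge_neg_right, huu, wedge_neg_right]
    linarith
  obtain ⟨TB, hTB, rfl⟩ := hD.exists_end hu hc hB h4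
  obtain ⟨TC, hTC, rfl⟩ := hD.exists_end hu hc hC h5
  have hA' : A = A₀ + (TC.card + q) • u := by
    rw [add_smul, ← add_assoc, hCA]; abel
  have hcard : TB.card = TC.card + q + p := by
    rw [hA', ← hA₀, add_assoc, ← add_smul] at hBA
    exact nsmul_left_cancel hu0 (add_left_cancel hBA)
  refine ⟨⟨_, _, hD.matchingsAt_end hu hTB, hD.matchingsAt_end hu hTC, fun M hM => ?_⟩, ?_⟩
  · rw [hA', hD.matchingsAt_eq hu] at hM
    obtain ⟨T, hT, rfl⟩ := hM
    rw [Finset.mem_coe, Finset.mem_powersetCard] at hT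
    have hsub : ∀ {T₀ : Finset D.Zigzag}, T₀ = ∅ ∨ T₀ = D.sideZigzags u →
        T₀ ⊆ D.sideZigzags u := by
      rintro T₀ (rfl | rfl) <;> simp
    have hb := hD.arisesByFlipping hu (hsub hTB) hT.1
    have hc := hD.arisesByFlipping hu (hsub hTC) hT.1
    have hp : (symmDiff TB T).card = p := by
      have := card_symmDiff_end hTB hT.1
      rw [hcard, hT.2, abs_of_nonneg (by push_cast; linarith)] at this
      push_cast at this
      omega
    have hq : (symmDiff TC T).card = q := by
      have := card_symmDiff_end hTC hT.1
      rw [hT.2, abs_of_nonpos (by push_cast; linarith)] at this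
      push_cast at this
      omega
    rw [hp] at hb
    rw [hq] at hc
    exact ⟨hb, hc⟩
  · rw [hA', hD.ncard_matchingsAt hu]
    -- If both corners are the same end of the side, then `p = q = 0` and the count is 1. This
    -- covers a corner `A` with `u` any supporting direction.
    rcases hTB with rfl | rfl
    · rw [Finset.card_empty] at hcard
      obtain ⟨rfl, rfl⟩ : q = 0 ∧ p = 0 := by omega
      have : TC.card = 0 := by omega
      simp [this]
    · rcases hTC with rfl | rfl
      · rw [Finset.card_empty] at hcard ⊢
        rw [hcard, zero_add, add_comm q p]
      · obtain ⟨rfl, rfl⟩ : q = 0 ∧ p = 0 := by omega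
        simp

end
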